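/- Let $K/F$ be an unramified quadratic extension of nonarchimedean local fields of characteristic $0$ with odd residue characteristic. Write $K=F(\sqrt{-D})$ with $D\in F$ and $\sqrt{-D}$ a unit of $K$. Let $\mathcal O_F,\mathcal O_K$ be the rings of integers, $U_F,U_K$ their unit groups, $q_F,q_K$ the cardinalities of the residue fields, and $\varpi\in F$ a uniformizer. Let $\kappa$ be the quadratic character of $F^\times$ associated with $K/F$ (equal to $1$ on norms from $K^\times$ and to $-1$ on all other elements), and let $\chi$ be a ramified unitary character of $K^\times$ with $\chi|_{F^\times}=\kappa$, of conductor exponent $f=f(\chi)$: the least $n\ge 0$ such that $\chi$ is trivial on $U_K\cap(1+\varpi^n\mathcal O_K)$. For a unitary character $\theta$ and a nontrivial continuous unitary additive character $\psi$ of a local field $H$ put $W(\theta,\psi)=\varepsilon(\theta,\psi,dx)/|\varepsilon(\theta,\psi,dx)|$, where $dx$ is any Haar measure on $H$ and $\varepsilon(\theta,\psi,dx)$ is the value at $s=0$ of the epsilon factor $\varepsilon(\theta|\cdot|^s,\psi,dx)$ in Tate's local functional equation. For any nontrivial continuous unitary additive character $\psi_F$ of $F$ put $$W(\kappa,\chi)=\frac{W(\chi,\psi_F\circ\mathrm{tr}_{K/F})}{W(\kappa,\psi_F)}.$$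 Let $d_Fx$, $d_Ky$ be Haar measures on $F$ and $K$, with volumes denoted $\mathrm{Meas}$, and let $dz$ be the quotient measure on $V=U_K/U_F$, so that $\int_V\int_{U_F}g(xz)\,d_Fx\,dz=\int_{U_K}g(y)\,d_Ky$ for continuous $g$ on $U_K$. For $z\in K$ let $\lambda(z)=1$ if $\mathrm{tr}_{K/F}(z)\in U_F$ and $\lambda(z)=0$ otherwise. Then $f\ge 1$ and $$W(\kappa,\chi)=(-1)^f\,\frac{q_K^{f/2}}{1-q_F^{-1}}\,\frac{\mathrm{Meas}(\mathcal O_F)}{\mathrm{Meas}(\mathcal O_K)}\,\chi^{-1}(\sqrt{-D})\int_V\lambda\!\left(\frac{z}{\varpi^f}\right)dz ,$$ where the factor multiplying $(-1)^f\chi^{-1}(\sqrt{-D})$ is positive. Hence $W(\kappa,\chi)$ has the same sign as $(-1)^f\chi^{-1}(\sqrt{-D})$; precisely, $W(\kappa,\chi)=(-1)^f\chi^{-1}(\sqrt{-D})\in\{1,-1\}$. -/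

import Mathlib

open MeasureTheory Filter Topology ValuativeRel

noncomputable section

namespace LocalRoot

section Field

/-- `x` is a uniformizer of the local field `K`. -/
def IsUniformizer {K : Type*} [Field K] [ValuativeRel K] (x : K) : Prop :=
  ∃ π : 𝒪[K], Irreducible π ∧ (π : K) = x

/-- The unit group `U = 𝒪ˣ`, as a subgroup of `Kˣ`. -/
def unitGroup (K : Type*) [Field K] [ValuativeRel K] : Subgroup Kˣ where
  carrier := {u | valuation K (u : K) = 1}
  mul_mem' := by
    intro a b ha hb
    simp only [Set.mem_ofPred_eq] at ha hb ⊢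
    simp [ha, hb]
  one_mem' := by simp
  inv_mem' := by
    intro a ha
    simp only [Set.mem_ofPred_eq] at ha ⊢
    simp [ha]

/-- The cardinality `q` of the residue field. -/
def residueCard (K : Type*) [Field K] [ValuativeRel K] : ℕ := Nat.card 𝓀[K]

/-- The units lying in `1 + 𝔪ⁿ`; for `n = 0` these are all units. -/
def higherUnits (K : Type*) [Field K] [ValuativeRel K] (n : ℕ) : Set Kˣ :=
  {u | u ∈ unitGroup K ∧ ∃ a ∈ 𝓂[K] ^ n, (u : K) = 1 + (a : K)}

variable {K : Type*} [Field K] [ValuativeRel K] [TopologicalSpace K]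

/-- A unitary character of `Kˣ` is unramified if it is trivial on `U`. -/
def IsUnramifiedChar (χ : Kˣ →ₜ* Circle) : Prop := ∀ u ∈ unitGroup K, χ u = 1

/-- The conductor exponent `f(χ)`: the least `n` such that `χ` is trivial on `U ∩ (1 + 𝔪ⁿ)`. -/
def conductorExponent (χ : Kˣ →ₜ* Circle) : ℕ :=
  sInf {n : ℕ | ∀ u ∈ higherUnits K n, χ u = 1}

variable [IsNonarchimedeanLocalField K]

open Classical in
/-- The normalized absolute value `|x| = q ^ (-v(x))`, `|0| = 0`. -/
def normAbs (x : K) : ℝ :=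
  if x = 0 then 0 else
    (residueCard K : ℝ) ^
      (WithZero.log (IsNonarchimedeanLocalField.valueGroupWithZeroIsoInt K (valuation K x)))

variable (K) in
/-- Some uniformizer of `K`, as an element of `Kˣ`. -/
def uniformizer : Kˣ :=
  Units.mk0 (((IsDiscreteValuationRing.exists_irreducible 𝒪[K]).choose : 𝒪[K]) : K)
    (fun h => (IsDiscreteValuationRing.exists_irreducible 𝒪[K]).choose_spec.ne_zero
      (Subtype.ext h))

open Classical in
/-- The inverse of the local `L`-factor `L(χ, s)` for real `s`: it is `1 - χ(ϖ) q ^ (-s)` if `χ` is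
unramified and `1` if `χ` is ramified. -/
def invLFactor (χ : Kˣ →ₜ* Circle) (s : ℝ) : ℂ :=
  if IsUnramifiedChar χ then
    1 - (χ (uniformizer K) : ℂ) * (((residueCard K : ℝ) ^ (-s) : ℝ) : ℂ)
  else 1

variable [MeasurableSpace K]

/-- The Fourier transform `f̂(y) = ∫ f(x) ψ(xy) dx` with respect to the Haar measure `μ = dx`. -/
def fourier (ψ : AddChar K Circle) (μ : Measure K) (f : K → ℂ) (y : K) : ℂ :=
  ∫ x, f x * (ψ (x * y) : ℂ) ∂μ

open Classical in
/-- The local zeta integral `Z(f, χ, s) = ∫ f(x) χ(x) |x|ˢ dˣx` over `Kˣ`, where `dˣx = dx / |x|`.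
For `χ` unitary and `f` a Schwartz-Bruhat function it converges absolutely when `s > 0`. -/
def zetaIntegral (μ : Measure K) (f : K → ℂ) (χ : Kˣ →ₜ* Circle) (s : ℝ) : ℂ :=
  ∫ x, (if h : x = 0 then 0 else
    f x * (χ (Units.mk0 x h) : ℂ) * ((normAbs x ^ (s - 1) : ℝ) : ℂ)) ∂μ

/-- Tate's local functional equation at a real point `0 < s < 1`, with constant `e`:
`Z(f̂, χ⁻¹, 1 - s) / L(χ⁻¹, 1 - s) = e * Z(f, χ, s) / L(χ, s)`
for all Schwartz-Bruhat (locally constant, compactly supported) functions `f` on `K`. -/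
def SatisfiesFunctionalEquation (χ : Kˣ →ₜ* Circle) (ψ : AddChar K Circle) (μ : Measure K)
    (s : ℝ) (e : ℂ) : Prop :=
  ∀ f : K → ℂ, IsLocallyConstant f → HasCompactSupport f →
    zetaIntegral μ (fourier ψ μ f) χ⁻¹ (1 - s) * invLFactor χ⁻¹ (1 - s) =
      e * (zetaIntegral μ f χ s * invLFactor χ s)

/-- The epsilon factor `ε(χ |·|ˢ, ψ, dx)` for `χ` unitary and `0 < s < 1`: the constant in the local
functional equation. -/
def epsilonStrip (χ : Kˣ →ₜ* Circle) (ψ : AddChar K Circle) (μ : Measure K) (s : ℝ) : ℂ :=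
  Classical.epsilon (SatisfiesFunctionalEquation χ ψ μ s)

/-- The epsilon factor `ε(χ, ψ, dx)` of a unitary character `χ`. The function
`s ↦ ε(χ |·|ˢ, ψ, dx)` is entire, so its value at `s = 0` is its limit from the interval `(0, 1)`,
where both sides of the functional equation are given by convergent integrals. -/
def epsilonFactor (χ : Kˣ →ₜ* Circle) (ψ : AddChar K Circle) (μ : Measure K) : ℂ :=
  limUnder (𝓝[>] (0 : ℝ)) (fun s => epsilonStrip χ ψ μ s)

/-- The local root number `W(χ, ψ) = ε(χ, ψ, dx) / |ε(χ, ψ, dx)|`. -/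
def rootNumber (χ : Kˣ →ₜ* Circle) (ψ : AddChar K Circle) (μ : Measure K) : ℂ :=
  epsilonFactor χ ψ μ / (‖epsilonFactor χ ψ μ‖ : ℂ)

end Field

section Extension

/-- The extension `K/F` of local fields is unramified: uniformizers of `F` remain uniformizers
in `K` (ramification index one; residue fields are finite, hence perfect). -/
def IsUnramifiedExtension (F K : Type*) [Field F] [ValuativeRel F] [Field K] [ValuativeRel K]
    [Algebra F K] : Prop :=
  ∀ x : F, IsUniformizer x → IsUniformizer (algebraMap F K x)

open Classical in
/-- `κ` is the quadratic character of `Fˣ` associated with the quadratic extension `K/F`: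
it is `1` on norms from `Kˣ` and `-1` on all other elements. -/
def IsQuadraticCharacter (F K : Type*) [Field F] [TopologicalSpace F] [Field K] [Algebra F K]
    (κ : Fˣ →ₜ* Circle) : Prop :=
  ∀ x : Fˣ, (κ x : ℂ) = if ∃ y : Kˣ, Algebra.norm F (y : K) = (x : F) then 1 else -1

/-- The additive character `ψ_K = ψ_F ∘ tr_{K/F}`. -/
def traceChar {F : Type*} (K : Type*) [Field F] [Field K] [Algebra F K]
    (ψ : AddChar F Circle) : AddChar K Circle :=
  ψ.compAddMonoidHom (Algebra.trace F K).toAddMonoidHom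

/-- The relative local root number `W(κ, χ) = W(χ, ψ_K) / W(κ, ψ_F)`. -/
def relativeRootNumber {F K : Type*}
    [Field F] [ValuativeRel F] [TopologicalSpace F] [IsNonarchimedeanLocalField F]
    [MeasurableSpace F]
    [Field K] [ValuativeRel K] [TopologicalSpace K] [IsNonarchimedeanLocalField K]
    [MeasurableSpace K] [Algebra F K]
    (κ : Fˣ →ₜ* Circle) (χ : Kˣ →ₜ* Circle) (ψ : AddChar F Circle)
    (μF : Measure F) (μK : Measure K) : ℂ :=
  rootNumber χ (traceChar K ψ) μK / rootNumber κ ψ μF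

variable (F K : Type*) [Field F] [ValuativeRel F] [Field K] [ValuativeRel K] [Algebra F K]

/-- The group `V = U_K / U_F`. -/
abbrev UnitQuotient : Type _ :=
  unitGroup K ⧸
    ((unitGroup F).map (Units.map (algebraMap F K : F →* K))).subgroupOf (unitGroup K)

/-- The quotient measure `dz = d_K y / d_F x` on `V`, the invariant measure with
`∫_V (∫_{U_F} f(xz) d_F x) dz = ∫_{U_K} f(y) d_K y`. Testing this relation on functions `f = g ∘ π`,
where `π : U_K → V` is the projection, it says `Meas(U_F) ∫_V g dz = ∫_{U_K} g(π(y)) d_K y`: so `dz`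
is the push-forward under `π` of the restriction of `d_K y` to `U_K`, divided by `Meas(U_F)`. -/
def quotientMeasure [MeasurableSpace F] [MeasurableSpace K] (μF : Measure F) (μK : Measure K) :
    Measure (UnitQuotient F K) :=
  (μF {x : F | valuation F x = 1})⁻¹ •
    (μK.comap (fun u : unitGroup K => ((u : Kˣ) : K))).map
      (fun u : unitGroup K => (u : UnitQuotient F K))

open Classical in
/-- The function `λ` on `K`: `λ(z) = 1` if `tr_{K/F}(z) ∈ U_F`, and `λ(z) = 0` otherwise. -/
def lam (z : K) : ℝ := if valuation F (Algebra.trace F K z) = 1 then 1 else 0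

/-- The integral `∫_V λ(z / ϖᶠ) dz` for `ϖ ∈ F`. The trace is `F`-linear, so that `λ(z / ϖᶠ)` does
not depend on the representative `z ∈ U_K` of a class in `V`. -/
def lamIntegral [MeasurableSpace F] [MeasurableSpace K] (μF : Measure F) (μK : Measure K)
    (ϖ : F) (f : ℕ) : ℝ :=
  ∫ z : UnitQuotient F K,
    lam F K (((Quotient.out z : unitGroup K) : Kˣ) / (algebraMap F K ϖ) ^ f : K)
      ∂(quotientMeasure F K μF μK)

end Extension

end LocalRoot

/-! Write `δ` for the unit `√-D`, and let `a` in `F` generate the largest fractional ideal on which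
`ψ` is trivial. Both root numbers are computed from the local functional equation. Its constant can
be read off from one test function with nonzero zeta integral, by Tate's Fubini argument
(`zetaIntegral_fourier_symm`, `epsilonStrip_eq`).

Since `2` and `D` are units, the form `a² + D b²` represents every unit of `F`, so all units are
norms and `κ` is unramified. A uniformizer is not a norm, so `κ(ϖ) = -1`. The test function `1_𝒪`
gives `W(κ, ψ) = κ⁻¹(a)`. For the ramified `χ`, the indicator of `1 + 𝔪^f` gives a positive multiple
of `χ⁻¹(b) ∫_{U_K} χ⁻¹(z) ψ(b tr z) dz` with `b = a/ϖ^f`. The same `a` serves `ψ ∘ tr`, because the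
extension is unramified and `2` is a unit. As `b` lies in `F`, the factor `χ⁻¹(b)` is
`κ⁻¹(a)(-1)^f`, and only the sign `(-1)^f` survives in the quotient of root numbers.

It remains to see that the Gauss integral is a positive multiple of `χ⁻¹(δ)` (`gaussIntegral_eq`).
Since `χ` is trivial on `U_F`, the factor `ψ(b tr z)` may be averaged over `z ↦ xz` with `x` in
`U_F`. The average is a combination of the indicators of `tr z ∈ ϖ^f 𝒪_F` and `tr z ∈ ϖ^(f-1) 𝒪_F`.
The second contributes zero, since `χ` is nontrivial on `1 + 𝔪^(f-1)`. On the first, `z` lies in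
`U_F δ (1 + 𝔪^f)`, where `χ` is constantly `χ(δ)`.

The explicit constant is a separate volume computation: in the coordinates `K = F ⊕ F δ` every
factor cancels and it equals `1` (`constant_eq_one`). Finally `δ² = -D` is a unit of `F`, so `χ(δ)²
= 1`. -/

namespace LocalRoot

/-! ### The normalized absolute value and the topology it defines. -/

section NormAbs

variable {K : Type*} [Field K] [ValuativeRel K] [TopologicalSpace K] [IsNonarchimedeanLocalField K]

lemma one_lt_residueCard (K : Type*) [Field K] [ValuativeRel K] [TopologicalSpace K]
    [IsNonarchimedeanLocalField K] : 1 < residueCard K :=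
  Finite.one_lt_card

lemma one_lt_residueCard_real (K : Type*) [Field K] [ValuativeRel K] [TopologicalSpace K]
    [IsNonarchimedeanLocalField K] : (1 : ℝ) < residueCard K := by
  exact_mod_cast one_lt_residueCard K

lemma residueCard_pos (K : Type*) [Field K] [ValuativeRel K] [TopologicalSpace K]
    [IsNonarchimedeanLocalField K] : (0 : ℝ) < residueCard K :=
  zero_lt_one.trans (one_lt_residueCard_real K)

@[simp] lemma normAbs_zero : normAbs (0 : K) = 0 := by simp [normAbs]

lemma normAbs_of_ne_zero {x : K} (hx : x ≠ 0) : normAbs x = (residueCard K : ℝ) ^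
      (WithZero.log (IsNonarchimedeanLocalField.valueGroupWithZeroIsoInt K (valuation K x))) := by
  simp [normAbs, hx]

lemma normAbs_pos {x : K} (hx : x ≠ 0) : 0 < normAbs x := by
  rw [normAbs_of_ne_zero hx]
  exact zpow_pos (residueCard_pos K) _

lemma normAbs_nonneg (x : K) : 0 ≤ normAbs x := by
  by_cases hx : x = 0
  · simp [hx]
  · exact (normAbs_pos hx).le

lemma normAbs_ne_zero {x : K} (hx : x ≠ 0) : normAbs x ≠ 0 := (normAbs_pos hx).ne'

@[simp] lemma normAbs_mul (x y : K) : normAbs (x * y) = normAbs x * normAbs y := by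
  by_cases hx : x = 0
  · simp [hx]
  by_cases hy : y = 0
  · simp [hy]
  rw [normAbs_of_ne_zero hx, normAbs_of_ne_zero hy, normAbs_of_ne_zero (mul_ne_zero hx hy),
    map_mul, map_mul, WithZero.log_mul, zpow_add₀ (residueCard_pos K).ne'] <;> simpa

@[simp] lemma normAbs_one : normAbs (1 : K) = 1 := by
  rw [normAbs_of_ne_zero one_ne_zero]; simp

variable (K) in
/-- The normalized absolute value as a homomorphism. -/
def normAbsHom : K →*₀ ℝ where
  toFun := normAbs
  map_zero' := normAbs_zero
  map_one' := normAbs_one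
  map_mul' := normAbs_mul

@[simp] lemma normAbs_inv (x : K) : normAbs x⁻¹ = (normAbs x)⁻¹ := map_inv₀ (normAbsHom K) x

@[simp] lemma normAbs_div (x y : K) : normAbs (x / y) = normAbs x / normAbs y :=
  map_div₀ (normAbsHom K) x y

@[simp] lemma normAbs_pow (x : K) (n : ℕ) : normAbs (x ^ n) = normAbs x ^ n :=
  map_pow (normAbsHom K) x n

@[simp] lemma normAbs_zpow (x : K) (n : ℤ) : normAbs (x ^ n) = normAbs x ^ n :=
  map_zpow₀ (normAbsHom K) x n

lemma normAbs_le_normAbs {x y : K} : normAbs x ≤ normAbs y ↔ valuation K x ≤ valuation K y := by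
  by_cases hx : x = 0
  · simp [hx, normAbs_nonneg]
  by_cases hy : y = 0
  · simp [hy, hx, (normAbs_pos hx).not_ge]
  rw [normAbs_of_ne_zero hx, normAbs_of_ne_zero hy,
    zpow_le_zpow_iff_right₀ (one_lt_residueCard_real K), WithZero.log_le_log (by simpa) (by simpa)]
  simp

lemma normAbs_lt_normAbs {x y : K} : normAbs x < normAbs y ↔ valuation K x < valuation K y := by
  simpa using (normAbs_le_normAbs (x := y) (y := x)).not

lemma normAbs_le_one {x : K} : normAbs x ≤ 1 ↔ valuation K x ≤ 1 := by
  simpa using normAbs_le_normAbs (x := x) (y := 1)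

lemma normAbs_lt_one {x : K} : normAbs x < 1 ↔ valuation K x < 1 := by
  simpa using normAbs_lt_normAbs (x := x) (y := 1)

lemma normAbs_eq_one {x : K} : normAbs x = 1 ↔ valuation K x = 1 := by
  rw [le_antisymm_iff, le_antisymm_iff, normAbs_le_one]
  simpa using fun _ => (normAbs_le_normAbs (x := 1) (y := x))

lemma mem_unitGroup_iff {u : Kˣ} : u ∈ unitGroup K ↔ normAbs (u : K) = 1 :=
  normAbs_eq_one.symm

@[simp] lemma normAbs_neg (x : K) : normAbs (-x) = normAbs x :=
  le_antisymm (normAbs_le_normAbs.2 (by simp)) (normAbs_le_normAbs.2 (by simp))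

lemma normAbs_add_le (x y : K) : normAbs (x + y) ≤ max (normAbs x) (normAbs y) := by
  rcases le_max_iff.1 ((valuation K).map_add x y) with h | h
  · exact le_max_of_le_left (normAbs_le_normAbs.2 h)
  · exact le_max_of_le_right (normAbs_le_normAbs.2 h)

lemma normAbs_add_le_of_le {x y : K} {r : ℝ} (hx : normAbs x ≤ r) (hy : normAbs y ≤ r) :
    normAbs (x + y) ≤ r := (normAbs_add_le x y).trans (max_le hx hy)

lemma normAbs_add_lt_of_lt {x y : K} {r : ℝ} (hx : normAbs x < r) (hy : normAbs y < r) :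
    normAbs (x + y) < r := (normAbs_add_le x y).trans_lt (max_lt hx hy)

lemma normAbs_sub_le_of_le {x y : K} {r : ℝ} (hx : normAbs x ≤ r) (hy : normAbs y ≤ r) :
    normAbs (x - y) ≤ r := by
  rw [sub_eq_add_neg]; exact normAbs_add_le_of_le hx (by simpa)

lemma normAbs_add_eq_of_lt {x y : K} (h : normAbs y < normAbs x) : normAbs (x + y) = normAbs x := by
  apply le_antisymm (normAbs_add_le_of_le le_rfl h.le)
  by_contra! h'
  have := normAbs_add_lt_of_lt h' (show normAbs (-y) < normAbs x by simpa)
  simp at this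

lemma exists_normAbs_eq {x : K} (hx : x ≠ 0) : ∃ n : ℤ, normAbs x = (residueCard K : ℝ) ^ n :=
  ⟨_, normAbs_of_ne_zero hx⟩

lemma IsUniformizer.ne_zero {K : Type*} [Field K] [ValuativeRel K] {ϖ : K} (h : IsUniformizer ϖ) : ϖ ≠ 0 := by
  obtain ⟨p, hp, rfl⟩ := h
  simpa using hp.ne_zero

lemma mem_maximalIdeal_iff {x : 𝒪[K]} : x ∈ 𝓂[K] ↔ normAbs (x : K) < 1 := by
  rw [IsLocalRing.mem_maximalIdeal, mem_nonunits_iff, normAbs_lt_one]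
  exact Valuation.Integer.not_isUnit_iff_valuation_lt_one

/-- The value group is all of `q^ℤ`, so some `y` has absolute value `q⁻¹`. It lies in the maximal
ideal, hence is a multiple of `ϖ`, which gives `q⁻¹ ≤ |ϖ|`; discreteness and `|ϖ| < 1` give the
other inequality. -/
lemma IsUniformizer.normAbs_eq {ϖ : K} (h : IsUniformizer ϖ) :
    normAbs ϖ = (residueCard K : ℝ)⁻¹ := by
  obtain ⟨p, hp, rfl⟩ := h
  have h0 : (p : K) ≠ 0 := by simpa using hp.ne_zero
  have hlt : normAbs (p : K) < 1 := by
    rw [← mem_maximalIdeal_iff, IsLocalRing.mem_maximalIdeal]; exact hp.1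
  obtain ⟨y, hy⟩ := ValuativeRel.valuation_surjective
    ((IsNonarchimedeanLocalField.valueGroupWithZeroIsoInt K).symm (WithZero.exp (-1)))
  have hy0 : y ≠ 0 := by
    rintro rfl
    rw [map_zero, eq_comm] at hy
    simp at hy
  have hyq : normAbs y = (residueCard K : ℝ)⁻¹ := by
    rw [normAbs_of_ne_zero hy0, hy]; simp
  have hy1 : normAbs y < 1 := by
    rw [hyq]; exact inv_lt_one_of_one_lt₀ (one_lt_residueCard_real K)
  apply le_antisymm
  · obtain ⟨n, hn⟩ := exists_normAbs_eq h0
    rw [hn, ← zpow_neg_one]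
    rw [hn] at hlt
    have : n < 0 := by
      by_contra! h
      exact hlt.not_ge (one_le_zpow₀ (one_lt_residueCard_real K).le h)
    exact zpow_le_zpow_right₀ (one_lt_residueCard_real K).le (by omega)
  · rw [← hyq]
    have hym : (⟨y, normAbs_le_one.1 hy1.le⟩ : 𝒪[K]) ∈ 𝓂[K] := mem_maximalIdeal_iff.2 hy1
    rw [hp.maximalIdeal_eq, Ideal.mem_span_singleton] at hym
    obtain ⟨z, hz⟩ := hym
    have hz' : y = (p : K) * z := congrArg Subtype.val hz
    rw [hz', normAbs_mul]
    exact mul_le_of_le_one_right (normAbs_nonneg _) (normAbs_le_one.2 z.2)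

variable (K) in
lemma exists_isUniformizer : ∃ ϖ : K, IsUniformizer ϖ := by
  obtain ⟨p, hp⟩ := IsDiscreteValuationRing.exists_irreducible 𝒪[K]
  exact ⟨p, p, hp, rfl⟩

variable (K) in
lemma isUniformizer_uniformizer : IsUniformizer (uniformizer K : K) :=
  ⟨_, (IsDiscreteValuationRing.exists_irreducible 𝒪[K]).choose_spec, rfl⟩

lemma exists_normAbs_eq_zpow {ϖ : K} (h : IsUniformizer ϖ) {x : K} (hx : x ≠ 0) :
    ∃ n : ℤ, normAbs x = normAbs ϖ ^ n := by
  obtain ⟨n, hn⟩ := exists_normAbs_eq hx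
  exact ⟨-n, by rw [hn, h.normAbs_eq, inv_zpow', neg_neg]⟩

lemma IsUniformizer.normAbs_lt_one {ϖ : K} (h : IsUniformizer ϖ) : normAbs ϖ < 1 := by
  rw [h.normAbs_eq]; exact inv_lt_one_of_one_lt₀ (one_lt_residueCard_real K)

lemma IsUniformizer.normAbs_pos {ϖ : K} (h : IsUniformizer ϖ) : 0 < normAbs ϖ :=
  LocalRoot.normAbs_pos h.ne_zero

/-- Discreteness of the value group. This turns open balls into closed ones, so that a sphere is a
difference of two closed balls. -/
lemma normAbs_le_mul_iff_lt {ϖ : K} (h : IsUniformizer ϖ) {x y : K} (hy : y ≠ 0) :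
    normAbs x ≤ normAbs ϖ * normAbs y ↔ normAbs x < normAbs y := by
  constructor
  · exact fun hx => hx.trans_lt (mul_lt_of_lt_one_left (normAbs_pos hy) h.normAbs_lt_one)
  · intro hlt
    by_cases hx : x = 0
    · simpa [hx] using mul_nonneg (normAbs_nonneg ϖ) (normAbs_nonneg y)
    obtain ⟨n, hn⟩ := exists_normAbs_eq_zpow h hx
    obtain ⟨m, hm⟩ := exists_normAbs_eq_zpow h hy
    rw [hn, hm] at hlt ⊢
    rw [zpow_lt_zpow_iff_right_of_lt_one₀ h.normAbs_pos h.normAbs_lt_one] at hlt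
    rw [mul_comm, ← zpow_add_one₀ h.normAbs_pos.ne']
    exact zpow_le_zpow_right_of_le_one₀ h.normAbs_pos h.normAbs_lt_one.le (by omega)

lemma mem_maximalIdeal_pow_iff {ϖ : K} (h : IsUniformizer ϖ) (n : ℕ) {x : 𝒪[K]} :
    x ∈ 𝓂[K] ^ n ↔ normAbs (x : K) ≤ normAbs ϖ ^ n := by
  obtain ⟨p, hp, rfl⟩ := h
  rw [hp.maximalIdeal_eq, Ideal.span_singleton_pow, Ideal.mem_span_singleton,
    (Valuation.integer.integers (valuation K)).dvd_iff_le, ← normAbs_pow, normAbs_le_normAbs]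
  rw [map_pow]; rfl

lemma mem_higherUnits_iff {ϖ : K} (h : IsUniformizer ϖ) (n : ℕ) {u : Kˣ} :
    u ∈ higherUnits K n ↔ normAbs (u : K) = 1 ∧ normAbs ((u : K) - 1) ≤ normAbs ϖ ^ n := by
  constructor
  · rintro ⟨hu, a, ha, hua⟩
    rw [mem_maximalIdeal_pow_iff h] at ha
    exact ⟨mem_unitGroup_iff.1 hu, by simpa [hua]⟩
  · rintro ⟨hu, ha⟩
    have h1 : normAbs ((u : K) - 1) ≤ 1 :=
      ha.trans (pow_le_one₀ (normAbs_nonneg _) h.normAbs_lt_one.le)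
    exact ⟨mem_unitGroup_iff.2 hu, ⟨_, normAbs_le_one.1 h1⟩, (mem_maximalIdeal_pow_iff h n).2 ha,
      by simp⟩

/-! ### Topology -/

variable (K) in
lemma nhds_zero_hasBasis : (𝓝 (0 : K)).HasBasis (fun ε : ℝ => 0 < ε) (fun ε => {x | normAbs x < ε}) := by
  refine (IsValuativeTopology.hasBasis_nhds_zero' K).to_hasBasis ?_ ?_
  · intro γ hγ
    obtain ⟨y, rfl⟩ := ValuativeRel.valuation_surjective γ
    exact ⟨normAbs y, normAbs_pos (by simpa using hγ), fun x hx => normAbs_lt_normAbs.1 hx⟩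
  · intro ε hε
    obtain ⟨ϖ, h⟩ := exists_isUniformizer K
    obtain ⟨n, hn⟩ := exists_pow_lt_of_lt_one hε h.normAbs_lt_one
    refine ⟨valuation K (ϖ ^ n), by simp [h.ne_zero], fun x hx => ?_⟩
    exact (normAbs_lt_normAbs.2 hx).trans (by simpa)

lemma normAbs_tendsto_zero : Tendsto (normAbs : K → ℝ) (𝓝 0) (𝓝 0) := by
  rw [Metric.nhds_basis_ball.tendsto_right_iff]
  intro ε hε
  filter_upwards [(nhds_zero_hasBasis K).mem_of_mem hε] with x hx
  simpa [abs_of_nonneg (normAbs_nonneg x)] using hx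

lemma continuous_normAbs : Continuous (normAbs : K → ℝ) := by
  rw [continuous_iff_continuousAt]
  intro x
  by_cases hx : x = 0
  · subst hx; simpa [ContinuousAt] using normAbs_tendsto_zero
  · have : Tendsto (fun y : K => normAbs (y - x)) (𝓝 x) (𝓝 0) := by
      refine normAbs_tendsto_zero.comp ?_
      have : Continuous fun y : K => y - x := by fun_prop
      simpa using this.tendsto x
    refine tendsto_nhds_of_eventually_eq ?_
    filter_upwards [this.eventually_lt_const (normAbs_pos hx)] with y hy
    simpa using normAbs_add_eq_of_lt hy

lemma isCompact_normAbs_le (r : ℝ) : IsCompact {x : K | normAbs x ≤ r} := by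
  obtain ⟨ϖ, h⟩ := exists_isUniformizer K
  obtain ⟨n, hn⟩ := pow_unbounded_of_one_lt r ((one_lt_inv₀ h.normAbs_pos).2 h.normAbs_lt_one)
  refine (IsNonarchimedeanLocalField.isCompact_closedBall K (valuation K (ϖ⁻¹ ^ n))).of_isClosed_subset
    (isClosed_le continuous_normAbs continuous_const) fun x hx => ?_
  rw [Set.mem_ofPred_eq] at hx ⊢
  rw [← normAbs_le_normAbs]
  exact hx.trans (by simpa using hn.le)

lemma isOpen_normAbs_le {r : ℝ} (hr : 0 < r) : IsOpen {x : K | normAbs x ≤ r} := by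
  rw [isOpen_iff_mem_nhds]
  intro x hx
  have hx' : normAbs x ≤ r := hx
  have : Tendsto (fun y : K => normAbs (y - x)) (𝓝 x) (𝓝 0) := by
    have : Continuous fun y : K => normAbs (y - x) := continuous_normAbs.comp (by fun_prop)
    simpa using this.tendsto x
  filter_upwards [this.eventually_lt_const hr] with y hy
  simpa using normAbs_add_le_of_le hy.le hx'

/-- Second countability makes the Borel structure on products the product structure, as the Fubini
arguments below require. -/
instance secondCountableTopology_of_localField : SecondCountableTopology K := by
  let := IsTopologicalAddGroup.rightUniformSpace K
  have := isUniformAddGroup_of_addCommGroup (G := K)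
  let : (Valued.v (R := K)).RankOne :=
  { hom' := IsRankLeOne.nonempty.some.emb (R := K).comp MonoidWithZeroHom.ValueGroup₀.embedding
    strictMono' := IsRankLeOne.nonempty.some.strictMono.comp
        MonoidWithZeroHom.ValueGroup₀.embedding_strictMono }
  open scoped Valued in
  have : ProperSpace K := .of_nontriviallyNormedField_of_weaklyLocallyCompactSpace K
  open scoped Valued in
  exact secondCountable_of_proper (α := K)

instance t2Space_of_localField : T2Space K := by
  refine IsTopologicalAddGroup.t2Space_of_zero_sep fun x hx => ?_
  exact ⟨_, (nhds_zero_hasBasis K).mem_of_mem (normAbs_pos hx), fun h => lt_irrefl (normAbs x) h⟩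

end NormAbs

end LocalRoot
set_option linter.unusedSectionVars false

namespace LocalRoot

/-! ### Scaling of Haar measure and integrability of powers of the absolute value. -/

section Scaling

variable {K : Type*} [Field K] [ValuativeRel K] [TopologicalSpace K] [IsNonarchimedeanLocalField K]

open Measure Pointwise

open scoped ENNReal NNReal

lemma residue_fiber_eq_vadd {ϖ : K} (h : IsUniformizer ϖ) (a : 𝒪[K]) :
    {x : K | ∃ hx : valuation K x ≤ 1, IsLocalRing.residue 𝒪[K] ⟨x, hx⟩ = IsLocalRing.residue 𝒪[K] a} =
      (a : K) +ᵥ {x : K | normAbs x ≤ normAbs ϖ} := by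
  ext x
  simp only [Set.mem_ofPred_eq, Set.mem_vadd_set_iff_neg_vadd_mem, vadd_eq_add]
  constructor
  · rintro ⟨hx, hr⟩
    rw [← sub_eq_zero, ← map_sub, IsLocalRing.residue_eq_zero_iff, ← pow_one 𝓂[K],
      mem_maximalIdeal_pow_iff h] at hr
    simpa [neg_add_eq_sub] using hr
  · intro hx
    have hx1 : normAbs x ≤ 1 := by
      have := normAbs_add_le_of_le (normAbs_le_one.2 a.2) (hx.trans h.normAbs_lt_one.le)
      simpa using this
    refine ⟨normAbs_le_one.1 hx1, ?_⟩
    rw [← sub_eq_zero, ← map_sub, IsLocalRing.residue_eq_zero_iff, ← pow_one 𝓂[K],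
      mem_maximalIdeal_pow_iff h]
    simpa [neg_add_eq_sub] using hx

variable [MeasurableSpace K] [BorelSpace K] (μ : Measure K) [μ.IsAddHaarMeasure]

lemma measurableSet_normAbs_le (r : ℝ) : MeasurableSet {x : K | normAbs x ≤ r} :=
  measurableSet_le continuous_normAbs.measurable measurable_const

lemma measure_normAbs_le_lt_top (r : ℝ) : μ {x : K | normAbs x ≤ r} < ∞ :=
  (isCompact_normAbs_le r).measure_lt_top

lemma measure_normAbs_le_pos {r : ℝ} (hr : 0 < r) : 0 < μ {x : K | normAbs x ≤ r} :=
  (isOpen_normAbs_le hr).measure_pos μ ⟨0, by simpa using hr.le⟩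

/-- The ring of integers is the disjoint union of `q` additive translates of the maximal ideal, one
for each residue class. -/
lemma residueCard_mul_measure {ϖ : K} (h : IsUniformizer ϖ) :
    (residueCard K : ℝ≥0∞) * μ {x : K | normAbs x ≤ normAbs ϖ} = μ {x : K | normAbs x ≤ 1} := by
  choose σ hσ using IsLocalRing.residue_surjective (R := 𝒪[K])
  have hfib : ∀ r, ((σ r : 𝒪[K]) : K) +ᵥ {x : K | normAbs x ≤ normAbs ϖ} =
      {x : K | ∃ hx : valuation K x ≤ 1, IsLocalRing.residue 𝒪[K] ⟨x, hx⟩ = r} := fun r => by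
    rw [← residue_fiber_eq_vadd h, hσ]
  have hU : {x : K | normAbs x ≤ 1} = ⋃ r, ((σ r : 𝒪[K]) : K) +ᵥ {x : K | normAbs x ≤ normAbs ϖ} := by
    ext x
    simp only [hfib, Set.mem_iUnion, Set.mem_ofPred_eq, normAbs_le_one]
    exact ⟨fun hx => ⟨_, hx, rfl⟩, fun ⟨_, hx, _⟩ => hx⟩
  have : Finite (IsLocalRing.ResidueField 𝒪[K]) := inferInstanceAs (Finite 𝓀[K])
  have : Fintype (IsLocalRing.ResidueField 𝒪[K]) := Fintype.ofFinite _
  rw [hU, measure_iUnion]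
  · simp [measure_vadd, residueCard]
  · intro r s hrs
    rw [Function.onFun, hfib, hfib, Set.disjoint_left]
    rintro x ⟨hx, h1⟩ ⟨hx', h2⟩
    exact hrs (h1.symm.trans h2)
  · exact fun r => (measurableSet_normAbs_le _).const_vadd _

lemma units_smul_normAbs_le (u : Kˣ) (r : ℝ) :
    u • {x : K | normAbs x ≤ r} = {x : K | normAbs x ≤ normAbs (u : K) * r} := by
  ext x
  rw [Set.mem_smul_set_iff_inv_smul_mem, Units.smul_def]
  simp [inv_mul_le_iff₀ (normAbs_pos u.ne_zero)]

/-- Both sides are multiplicative, so it is enough to test units, which preserve the unit ball, and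
a uniformizer, which carries it to a subgroup of index `q`. -/
lemma distribHaarChar_eq_normAbs (u : Kˣ) : (distribHaarChar K u : ℝ) = normAbs (u : K) := by
  obtain ⟨ϖ, h⟩ := exists_isUniformizer K
  borelize K
  let μ : Measure K := addHaar
  have h0 : μ {x : K | normAbs x ≤ 1} ≠ 0 := (measure_normAbs_le_pos μ one_pos).ne'
  have ht : μ {x : K | normAbs x ≤ 1} ≠ ∞ := (measure_normAbs_le_lt_top μ 1).ne
  have hunit : ∀ v : Kˣ, normAbs (v : K) = 1 → distribHaarChar K v = 1 := by
    intro v hv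
    refine distribHaarChar_eq_of_measure_smul_eq_mul (μ := μ) h0 ht ?_
    rw [units_smul_normAbs_le, hv]; simp
  have hϖ : distribHaarChar K (Units.mk0 ϖ h.ne_zero) = (residueCard K : ℝ≥0)⁻¹ := by
    refine distribHaarChar_eq_of_measure_smul_eq_mul (μ := μ) h0 ht ?_
    rw [units_smul_normAbs_le, mul_one, ← residueCard_mul_measure μ h, ← mul_assoc]
    have hq : (residueCard K : ℝ≥0) ≠ 0 := by exact_mod_cast (zero_lt_one.trans (one_lt_residueCard K)).ne'
    have : ((residueCard K : ℝ≥0)⁻¹ : ℝ≥0) * (residueCard K : ℝ≥0∞) = 1 := by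
      rw [show (residueCard K : ℝ≥0∞) = ((residueCard K : ℝ≥0) : ℝ≥0∞) by simp, ← ENNReal.coe_mul,
        inv_mul_cancel₀ hq, ENNReal.coe_one]
    rw [this, one_mul]
    rfl
  obtain ⟨n, hn⟩ := exists_normAbs_eq_zpow h u.ne_zero
  have h1 := hunit (u * (Units.mk0 ϖ h.ne_zero) ^ (-n)) (by
    simp [hn, mul_inv_cancel₀ (zpow_ne_zero n h.normAbs_pos.ne')])
  rw [map_mul, map_zpow, hϖ, zpow_neg, mul_inv_eq_one₀ (by
    refine zpow_ne_zero _ (inv_ne_zero ?_)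
    exact_mod_cast (zero_lt_one.trans (one_lt_residueCard K)).ne')] at h1
  rw [h1, hn, h.normAbs_eq]
  simp

lemma measure_mul_preimage {c : K} (hc : c ≠ 0) (s : Set K) :
    μ ((fun x => c * x) ⁻¹' s) = ENNReal.ofReal (normAbs c)⁻¹ * μ s := by
  have := distribHaarChar_mul μ (Units.mk0 c hc)⁻¹ s
  rw [show (fun x => c * x) ⁻¹' s = (Units.mk0 c hc)⁻¹ • s from ?_, ← this]
  · congr 1
    have hd := distribHaarChar_eq_normAbs (Units.mk0 c hc)⁻¹
    rw [Units.val_inv_eq_inv_val, Units.val_mk0, normAbs_inv] at hd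
    rw [← hd, ENNReal.ofReal_coe_nnreal]
  · ext x
    rw [Set.mem_smul_set_iff_inv_smul_mem, inv_inv, Units.smul_def]
    simp

lemma map_mul_left_eq {c : K} (hc : c ≠ 0) :
    μ.map (fun x => c * x) = ENNReal.ofReal (normAbs c)⁻¹ • μ := by
  ext s hs
  rw [map_apply (measurable_const_mul c) hs, measure_mul_preimage μ hc]
  rfl

lemma measurableEmbedding_mul_left₀ {c : K} (hc : c ≠ 0) : MeasurableEmbedding (fun x : K => c * x) :=
  (Homeomorph.mulLeft₀ c hc).measurableEmbedding

lemma integral_comp_mul_left_smul {E : Type*} [NormedAddCommGroup E] [NormedSpace ℝ E] {c : K}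
    (hc : c ≠ 0) (g : K → E) : ∫ x, g (c * x) ∂μ = (normAbs c)⁻¹ • ∫ x, g x ∂μ := by
  rw [← (measurableEmbedding_mul_left₀ hc).integral_map, map_mul_left_eq μ hc, integral_smul_measure,
    ENNReal.toReal_ofReal (inv_nonneg.2 (normAbs_nonneg c))]

lemma integral_comp_mul_left {c : K} (hc : c ≠ 0) (g : K → ℂ) :
    ∫ x, g (c * x) ∂μ = ((normAbs c)⁻¹ : ℝ) * ∫ x, g x ∂μ := by
  rw [integral_comp_mul_left_smul μ hc, Complex.real_smul]

lemma integral_eq_mul_integral_comp {c : K} (hc : c ≠ 0) (g : K → ℂ) :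
    ∫ x, g x ∂μ = (normAbs c : ℝ) * ∫ x, g (c * x) ∂μ := by
  rw [integral_comp_mul_left μ hc, ← mul_assoc, ← Complex.ofReal_mul,
    mul_inv_cancel₀ (normAbs_ne_zero hc), Complex.ofReal_one, one_mul]

lemma integrable_comp_mul_left {E : Type*} [NormedAddCommGroup E] {c : K} (hc : c ≠ 0) {g : K → E}
    (hg : Integrable g μ) : Integrable (fun x => g (c * x)) μ := by
  refine (measurableEmbedding_mul_left₀ hc).integrable_map_iff.1 ?_
  rw [map_mul_left_eq μ hc]
  exact hg.smul_measure ENNReal.ofReal_ne_top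

/-- Division by `ϖ` fixes `{0}` and multiplies volumes by `q > 1`, so the finite mass of `{0}`
vanishes; translation handles the other points. -/
instance nullSingletonClass_addHaar : NullSingletonClass μ := by
  refine ⟨fun x => ?_⟩
  obtain ⟨ϖ, h⟩ := exists_isUniformizer K
  have h0 : μ {(0 : K)} = 0 := by
    have := measure_mul_preimage μ h.ne_zero {0}
    rw [show (fun x => ϖ * x) ⁻¹' {0} = {0} by ext; simp [h.ne_zero], h.normAbs_eq, inv_inv,
      ENNReal.ofReal_natCast] at this
    by_contra h0
    have ht : μ {(0 : K)} ≠ ∞ := isCompact_singleton.measure_lt_top.ne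
    have h1 : (residueCard K : ℝ≥0∞) = 1 := by
      have := this.symm
      rw [ENNReal.mul_eq_right h0 ht] at this
      exact this
    have := one_lt_residueCard K
    norm_cast at h1
    omega
  rw [← h0]
  have := measure_preimage_add μ (-x) {0}
  rw [← this]
  congr 1
  ext y
  simp only [Set.mem_preimage, Set.mem_singleton_iff, neg_add_eq_zero, eq_comm]

lemma integrableOn_normAbs_rpow {s : ℝ} (hs : 0 < s) (r : ℝ) :
    IntegrableOn (fun x : K => normAbs x ^ (s - 1)) {x | normAbs x ≤ r} μ := by
  obtain ⟨ϖ, h⟩ := exists_isUniformizer K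
  have hq := one_lt_residueCard_real K
  have hmeas : Measurable fun x : K => normAbs x ^ (s - 1) :=
    continuous_normAbs.measurable.pow_const _
  -- it suffices to treat the unit ball
  have hone : IntegrableOn (fun x : K => normAbs x ^ (s - 1)) {x | normAbs x ≤ 1} μ := by
    refine ⟨hmeas.aestronglyMeasurable, ?_⟩
    rw [HasFiniteIntegral]
    let S : ℕ → Set K := fun n => {x | normAbs x = normAbs ϖ ^ n}
    have hS : ∀ n, MeasurableSet (S n) := fun n =>
      measurableSet_eq_fun continuous_normAbs.measurable measurable_const
    have hcover : {x : K | normAbs x ≤ 1} ⊆ {0} ∪ ⋃ n, S n := by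
      intro x hx
      by_cases hx0 : x = 0
      · exact Or.inl hx0
      · obtain ⟨n, hn⟩ := exists_normAbs_eq_zpow h hx0
        have hx1 : normAbs x ≤ 1 := hx
        rw [hn] at hx1
        have : 0 ≤ n := by
          by_contra! hneg
          exact hx1.not_gt (one_lt_zpow_of_neg₀ h.normAbs_pos h.normAbs_lt_one hneg)
        lift n to ℕ using this
        exact Or.inr (Set.mem_iUnion.2 ⟨n, by simpa [S] using hn⟩)
    -- The sphere `S n` is `ϖ^n S 0`. Hence the integral over it is a constant times `(|ϖ|^s)^n`, a
    -- geometric series that converges exactly because `s > 0`.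
    have hvol : ∀ n, μ (S n) = ENNReal.ofReal (normAbs ϖ ^ n) * μ (S 0) := by
      intro n
      have := measure_mul_preimage μ (inv_ne_zero (pow_ne_zero n h.ne_zero)) (S 0)
      rw [normAbs_inv, inv_inv, normAbs_pow] at this
      rw [← this]
      congr 1
      ext x
      have : normAbs ϖ ^ n ≠ 0 := pow_ne_zero _ h.normAbs_pos.ne'
      simp only [S, Set.mem_ofPred_eq, Set.mem_preimage, normAbs_mul, normAbs_inv, normAbs_pow, pow_zero]
      rw [inv_mul_eq_one₀ this, eq_comm]
    have hfin : μ (S 0) < ∞ := (measure_mono (fun x hx => by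
      simp only [S, pow_zero, Set.mem_ofPred_eq] at hx; exact hx.le)).trans_lt (measure_normAbs_le_lt_top μ 1)
    calc ∫⁻ x in {x : K | normAbs x ≤ 1}, ‖normAbs x ^ (s - 1)‖ₑ ∂μ
        ≤ ∫⁻ x in {0} ∪ ⋃ n, S n, ‖normAbs x ^ (s - 1)‖ₑ ∂μ := lintegral_mono_set hcover
      _ ≤ (∫⁻ x in {(0 : K)}, ‖normAbs x ^ (s - 1)‖ₑ ∂μ) + ∫⁻ x in ⋃ n, S n, ‖normAbs x ^ (s - 1)‖ₑ ∂μ :=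
          lintegral_union_le _ _ _
      _ = ∫⁻ x in ⋃ n, S n, ‖normAbs x ^ (s - 1)‖ₑ ∂μ := by
          rw [setLIntegral_measure_zero _ _ (measure_singleton 0), zero_add]
      _ ≤ ∑' n, ∫⁻ x in S n, ‖normAbs x ^ (s - 1)‖ₑ ∂μ := lintegral_iUnion_le _ _
      _ = ∑' n, ENNReal.ofReal ((normAbs ϖ ^ s) ^ n) * μ (S 0) := by
          congr 1; ext n
          rw [setLIntegral_congr_fun (g := fun _ => ENNReal.ofReal ((normAbs ϖ ^ n) ^ (s - 1))) (hS n),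
            setLIntegral_const, hvol, ← mul_assoc, ← ENNReal.ofReal_mul (Real.rpow_nonneg (pow_nonneg h.normAbs_pos.le _) _)]
          · congr 2
            have hp := pow_pos h.normAbs_pos n
            rw [Real.rpow_sub_one hp.ne', div_mul_cancel₀ _ hp.ne', ← Real.rpow_natCast,
              ← Real.rpow_natCast, ← Real.rpow_mul h.normAbs_pos.le, ← Real.rpow_mul h.normAbs_pos.le,
              mul_comm]
          · intro x hx
            simp only [S, Set.mem_ofPred_eq] at hx
            simp only [hx]
            rw [Real.enorm_eq_ofReal (Real.rpow_nonneg (pow_nonneg (normAbs_nonneg _) _) _)]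
      _ < ∞ := by
          rw [ENNReal.tsum_mul_right]
          refine ENNReal.mul_lt_top ?_ hfin
          rw [← ENNReal.ofReal_tsum_of_nonneg (fun n => pow_nonneg (Real.rpow_nonneg h.normAbs_pos.le _) _)]
          · exact ENNReal.ofReal_lt_top
          · exact summable_geometric_of_lt_one (Real.rpow_nonneg h.normAbs_pos.le _)
              (Real.rpow_lt_one h.normAbs_pos.le h.normAbs_lt_one hs)
  -- A power of `ϖ` shrinks the ball of radius `r` into the unit ball; the integrand is homogeneous
  -- under this scaling.
  obtain ⟨n, hn⟩ := pow_unbounded_of_one_lt r ((one_lt_inv₀ h.normAbs_pos).2 h.normAbs_lt_one)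
  have hc : (ϖ ^ n) ≠ 0 := pow_ne_zero _ h.ne_zero
  rw [← integrable_indicator_iff (measurableSet_normAbs_le _)] at hone
  have h2 := (integrable_comp_mul_left μ hc hone).const_mul ((normAbs (ϖ ^ n) ^ (s - 1))⁻¹)
  rw [← integrable_indicator_iff (measurableSet_normAbs_le _)]
  refine (h2.indicator (measurableSet_normAbs_le r)).congr (Eventually.of_forall fun x => ?_)
  by_cases hx : normAbs x ≤ r
  · have hp := pow_pos h.normAbs_pos n
    have hmem : ϖ ^ n * x ∈ {x : K | normAbs x ≤ 1} := by
      rw [inv_pow] at hn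
      simp only [Set.mem_ofPred_eq, normAbs_mul, normAbs_pow]
      calc _ ≤ normAbs ϖ ^ n * (normAbs ϖ ^ n)⁻¹ :=
            mul_le_mul_of_nonneg_left (hx.trans hn.le) hp.le
        _ = 1 := mul_inv_cancel₀ hp.ne'
    have hmem' : x ∈ {x : K | normAbs x ≤ r} := hx
    rw [Set.indicator_of_mem hmem', Set.indicator_of_mem hmem', Set.indicator_of_mem hmem, normAbs_mul, Real.mul_rpow (normAbs_nonneg _) (normAbs_nonneg _),
      inv_mul_cancel_left₀ (Real.rpow_pos_of_pos (normAbs_pos hc) _).ne']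
  · rw [Set.indicator_of_notMem (by exact hx), Set.indicator_of_notMem (by exact hx)]

end Scaling

end LocalRoot

namespace LocalRoot

/-! ### Tate's local functional equation. -/

section FunctionalEquation

lemma continuous_circle_coe : Continuous fun z : Circle => (z : ℂ) := by fun_prop

variable {K : Type*} [Field K] [ValuativeRel K] [TopologicalSpace K]

open Classical in
/-- The extension by zero of a unitary character of `Kˣ` to `K`. -/
def charExt (χ : Kˣ →ₜ* Circle) (x : K) : ℂ := if h : x = 0 then 0 else χ (Units.mk0 x h)

@[simp] lemma charExt_zero (χ : Kˣ →ₜ* Circle) : charExt χ 0 = 0 := by simp [charExt]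

lemma charExt_of_ne_zero (χ : Kˣ →ₜ* Circle) {x : K} (hx : x ≠ 0) :
    charExt χ x = χ (Units.mk0 x hx) := by simp [charExt, hx]

@[simp] lemma charExt_units (χ : Kˣ →ₜ* Circle) (u : Kˣ) : charExt χ (u : K) = χ u := by
  rw [charExt_of_ne_zero χ u.ne_zero]; simp

lemma charExt_mul (χ : Kˣ →ₜ* Circle) (x y : K) : charExt χ (x * y) = charExt χ x * charExt χ y := by
  by_cases hx : x = 0
  · simp [hx]
  by_cases hy : y = 0
  · simp [hy]
  rw [charExt_of_ne_zero χ hx, charExt_of_ne_zero χ hy, charExt_of_ne_zero χ (mul_ne_zero hx hy),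
    Units.mk0_mul, map_mul, Circle.coe_mul]

lemma charExt_inv_mul_cancel (χ : Kˣ →ₜ* Circle) {x : K} (hx : x ≠ 0) :
    charExt χ⁻¹ x * charExt χ x = 1 := by
  rw [charExt_of_ne_zero _ hx, charExt_of_ne_zero _ hx, ← Circle.coe_mul]
  exact congrArg _ (inv_mul_cancel (χ (Units.mk0 x hx)))

lemma norm_charExt_of_ne_zero (χ : Kˣ →ₜ* Circle) {x : K} (hx : x ≠ 0) : ‖charExt χ x‖ = 1 := by
  rw [charExt_of_ne_zero _ hx, Circle.norm_coe]

lemma norm_charExt_le (χ : Kˣ →ₜ* Circle) (x : K) : ‖charExt χ x‖ ≤ 1 := by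
  by_cases hx : x = 0
  · simp [hx]
  · exact (norm_charExt_of_ne_zero χ hx).le

variable [IsNonarchimedeanLocalField K] [MeasurableSpace K]

lemma zetaIntegral_eq (μ : Measure K) (f : K → ℂ) (χ : Kˣ →ₜ* Circle) (s : ℝ) :
    zetaIntegral μ f χ s = ∫ x, f x * charExt χ x * ((normAbs x ^ (s - 1) : ℝ) : ℂ) ∂μ := by
  rw [zetaIntegral]
  congr 1
  ext x
  by_cases hx : x = 0
  · simp [hx]
  · rw [dif_neg hx, charExt_of_ne_zero _ hx]

variable [BorelSpace K]

lemma measurable_charExt (χ : Kˣ →ₜ* Circle) : Measurable (charExt χ) := by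
  refine measurable_of_continuousOn_compl_singleton (0 : K) ?_
  rw [continuousOn_iff_continuous_domRestrict]
  have : Continuous fun x : {x : K // x ≠ 0} => (χ ((unitsHomeomorphNeZero (G₀ := K)).symm x) : ℂ) :=
    continuous_circle_coe.comp (χ.continuous_toFun.comp
      (unitsHomeomorphNeZero (G₀ := K)).symm.continuous)
  refine this.congr fun x => ?_
  have hx : (unitsHomeomorphNeZero (G₀ := K)).symm x = Units.mk0 (x : K) x.2 :=
    (unitsHomeomorphNeZero (G₀ := K)).symm_apply_eq.2 (Subtype.ext rfl)
  rw [hx]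
  exact (charExt_of_ne_zero χ x.2).symm

/-- Bounded measurable functions of bounded support. -/
structure IsTame (f : K → ℂ) : Prop where
  measurable : Measurable f
  bounded : ∃ C, ∀ x, ‖f x‖ ≤ C
  support : ∃ r, ∀ x, r < normAbs x → f x = 0

variable (μ : Measure K) [μ.IsAddHaarMeasure]

lemma IsTame.integrable_mul_rpow {f : K → ℂ} (hf : IsTame f) {s : ℝ} (hs : 0 < s) :
    Integrable (fun x => f x * ((normAbs x ^ (s - 1) : ℝ) : ℂ)) μ := by
  obtain ⟨C, hC⟩ := hf.bounded
  obtain ⟨r, hr⟩ := hf.support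
  have hm : Measurable fun x : K => normAbs x ^ (s - 1) := continuous_normAbs.measurable.pow_const _
  have h1 := ((integrable_indicator_iff (measurableSet_normAbs_le r)).2
    (integrableOn_normAbs_rpow μ hs r)).const_mul C
  refine h1.mono (hf.measurable.mul (Complex.measurable_ofReal.comp hm)).aestronglyMeasurable
    (Eventually.of_forall fun x => ?_)
  by_cases hx : normAbs x ≤ r
  · rw [Set.indicator_of_mem (by exact hx), norm_mul, norm_mul, Complex.norm_real]
    exact mul_le_mul_of_nonneg_right ((hC x).trans (Real.le_norm_self C)) (norm_nonneg _)
  · rw [hr x (not_le.1 hx), zero_mul, norm_zero]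
    exact norm_nonneg _

lemma IsTame.mul_charExt {f : K → ℂ} (hf : IsTame f) (χ : Kˣ →ₜ* Circle) :
    IsTame (fun x => f x * charExt χ x) := by
  obtain ⟨C, hC⟩ := hf.bounded
  obtain ⟨r, hr⟩ := hf.support
  refine ⟨hf.measurable.mul (measurable_charExt χ), ⟨C, fun x => ?_⟩, ⟨r, fun x hx => by simp [hr x hx]⟩⟩
  rw [norm_mul]
  exact (mul_le_of_le_one_right (norm_nonneg _) (norm_charExt_le χ x)).trans (hC x)

lemma IsTame.integrable {f : K → ℂ} (hf : IsTame f) : Integrable f μ := by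
  simpa using hf.integrable_mul_rpow μ one_pos

lemma IsTame.integrable_zeta {f : K → ℂ} (hf : IsTame f) (χ : Kˣ →ₜ* Circle) {s : ℝ} (hs : 0 < s) :
    Integrable (fun x => f x * charExt χ x * ((normAbs x ^ (s - 1) : ℝ) : ℂ)) μ :=
  (hf.mul_charExt χ).integrable_mul_rpow μ hs

variable {μ}

/-- Replace `y` by `xy` in the product of the two integrals: the values of `χ` and the powers of
`|x|` cancel, and plain additive `dx` remains. When `g` is a Fourier transform, the inner integral
over `x` is symmetric in the two test functions. -/
lemma zetaIntegral_mul_zetaIntegral {f g : K → ℂ} (hf : IsTame f) (hg : IsTame g)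
    (χ : Kˣ →ₜ* Circle) {s : ℝ} (hs0 : 0 < s) (hs1 : s < 1) :
    zetaIntegral μ f χ s * zetaIntegral μ g χ⁻¹ (1 - s) =
      ∫ y, (∫ x, f x * g (x * y) ∂μ) * (charExt χ⁻¹ y * ((normAbs y ^ (-s) : ℝ) : ℂ)) ∂μ := by
  set G : K → ℂ := fun y => g y * charExt χ⁻¹ y * ((normAbs y ^ (1 - s - 1) : ℝ) : ℂ) with hG
  have hGi : Integrable G μ := hg.integrable_zeta μ χ⁻¹ (by linarith)
  have key : ∀ x y : K, x ≠ 0 → f x * (g (x * y) * (charExt χ⁻¹ y * ((normAbs y ^ (-s) : ℝ) : ℂ))) =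
      f x * charExt χ x * ((normAbs x ^ s : ℝ) : ℂ) * G (x * y) := by
    intro x y hx
    have h1 : normAbs (x * y) ^ (1 - s - 1) = normAbs x ^ (-s) * normAbs y ^ (-s) := by
      rw [normAbs_mul, Real.mul_rpow (normAbs_nonneg _) (normAbs_nonneg _)]
      ring_nf
    have h2 : ((normAbs x ^ s : ℝ) : ℂ) * ((normAbs x ^ (-s) : ℝ) : ℂ) = 1 := by
      rw [← Complex.ofReal_mul, ← Real.rpow_add (normAbs_pos hx)]; simp
    have h3 := charExt_inv_mul_cancel χ hx
    simp only [hG, h1, charExt_mul, Complex.ofReal_mul]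
    calc _ = f x * g (x * y) * charExt χ⁻¹ y * ((normAbs y ^ (-s) : ℝ) : ℂ) * 1 * 1 := by ring
      _ = f x * g (x * y) * charExt χ⁻¹ y * ((normAbs y ^ (-s) : ℝ) : ℂ) *
          (charExt χ⁻¹ x * charExt χ x) *
          (((normAbs x ^ s : ℝ) : ℂ) * ((normAbs x ^ (-s) : ℝ) : ℂ)) := by rw [h2, h3]
      _ = _ := by ring
  have hne : ∀ᵐ x ∂μ, x ≠ 0 := by
    rw [ae_iff]; simp
  have hpow : ∀ x : K, x ≠ 0 → normAbs x ^ s * (normAbs x)⁻¹ = normAbs x ^ (s - 1) := by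
    intro x hx
    rw [Real.rpow_sub_one (normAbs_ne_zero hx), div_eq_mul_inv]
  have hint : Integrable (Function.uncurry fun x y =>
      f x * (g (x * y) * (charExt χ⁻¹ y * ((normAbs y ^ (-s) : ℝ) : ℂ)))) (μ.prod μ) := by
    have hm : Measurable (Function.uncurry fun x y =>
      f x * (g (x * y) * (charExt χ⁻¹ y * ((normAbs y ^ (-s) : ℝ) : ℂ)))) := by
      have hm1 : Measurable (normAbs : K → ℝ) := continuous_normAbs.measurable
      have := measurable_charExt (χ⁻¹ : Kˣ →ₜ* Circle)
      have := hf.measurable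
      have := hg.measurable
      unfold Function.uncurry
      fun_prop
    rw [integrable_prod_iff hm.aestronglyMeasurable]
    constructor
    · filter_upwards [hne] with x hx
      simp only [Function.uncurry, key x _ hx]
      exact (integrable_comp_mul_left μ hx hGi).const_mul _
    · have h1 := ((hf.mul_charExt χ).integrable_mul_rpow μ hs0).norm.mul_const (∫ y, ‖G y‖ ∂μ)
      refine h1.congr ?_
      filter_upwards [hne] with x hx
      simp only [Function.uncurry, key x _ hx]
      simp_rw [norm_mul _ (G _)]
      rw [integral_const_mul, integral_comp_mul_left_smul μ hx (fun y => ‖G y‖), smul_eq_mul, ← mul_assoc]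
      congr 1
      rw [norm_mul, norm_mul (_ * _), mul_assoc, Complex.norm_real, Complex.norm_real, ← hpow x hx,
        norm_mul (normAbs x ^ s), norm_inv]
      simp [abs_of_nonneg (normAbs_nonneg x)]
  calc zetaIntegral μ f χ s * zetaIntegral μ g χ⁻¹ (1 - s)
      = ∫ x, f x * charExt χ x * ((normAbs x ^ (s - 1) : ℝ) : ℂ) * ∫ y, G y ∂μ ∂μ := by
        rw [zetaIntegral_eq, zetaIntegral_eq, integral_mul_const]
    _ = ∫ x, ∫ y, f x * (g (x * y) * (charExt χ⁻¹ y * ((normAbs y ^ (-s) : ℝ) : ℂ))) ∂μ ∂μ := by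
        refine integral_congr_ae ?_
        filter_upwards [hne] with x hx
        simp only [key x _ hx]
        rw [integral_const_mul, integral_comp_mul_left μ hx G, ← hpow x hx]
        push_cast
        ring
    _ = ∫ y, ∫ x, f x * (g (x * y) * (charExt χ⁻¹ y * ((normAbs y ^ (-s) : ℝ) : ℂ))) ∂μ ∂μ :=
        integral_integral_swap hint
    _ = _ := by
        congr 1; ext y
        rw [← integral_mul_const]
        congr 1; ext x
        ring

lemma integral_mul_fourier_symm {f g : K → ℂ} (hf : Integrable f μ) (hg : Integrable g μ)
    {ψ : AddChar K Circle} (hψ : Continuous ψ) (y : K) :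
    ∫ x, f x * fourier ψ μ g (x * y) ∂μ = ∫ x, g x * fourier ψ μ f (x * y) ∂μ := by
  have hint : Integrable (Function.uncurry fun x z => f x * (g z * (ψ (z * (x * y)) : ℂ))) (μ.prod μ) := by
    have h1 := hf.mul_prod hg
    have hc : Continuous fun p : K × K => (ψ (p.2 * (p.1 * y)) : ℂ) :=
      continuous_circle_coe.comp (hψ.comp (by fun_prop))
    refine (h1.mul_bdd (c := 1) hc.aestronglyMeasurable
      (Eventually.of_forall fun p => (Circle.norm_coe _).le)).congr (Eventually.of_forall fun p => ?_)
    simp [Function.uncurry, mul_assoc]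
  simp only [fourier, ← integral_const_mul]
  rw [integral_integral_swap hint]
  congr 1; ext z
  congr 1; ext x
  rw [mul_left_comm z x y]
  ring

lemma zetaIntegral_fourier_symm {f g : K → ℂ} (hf : IsTame f) (hg : IsTame g)
    {ψ : AddChar K Circle} (hψ : Continuous ψ) (hf' : IsTame (fourier ψ μ f))
    (hg' : IsTame (fourier ψ μ g)) (χ : Kˣ →ₜ* Circle) {s : ℝ} (hs0 : 0 < s) (hs1 : s < 1) :
    zetaIntegral μ f χ s * zetaIntegral μ (fourier ψ μ g) χ⁻¹ (1 - s) =
      zetaIntegral μ g χ s * zetaIntegral μ (fourier ψ μ f) χ⁻¹ (1 - s) := by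
  rw [zetaIntegral_mul_zetaIntegral hf hg' χ hs0 hs1, zetaIntegral_mul_zetaIntegral hg hf' χ hs0 hs1]
  simp only [integral_mul_fourier_symm (hf.integrable μ) (hg.integrable μ) hψ]

variable (μ)

lemma isTame_of_isLocallyConstant {f : K → ℂ} (hf : IsLocallyConstant f) (hc : HasCompactSupport f) :
    IsTame f := by
  have hcont := hf.continuous
  refine ⟨hcont.measurable, hcont.bounded_above_of_compact_support hc |>.imp fun C hC => hC, ?_⟩
  obtain ⟨r, hr⟩ := (hc.isCompact.image continuous_normAbs).bddAbove
  refine ⟨r, fun x hx => by_contra fun h => ?_⟩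
  exact hx.not_ge (hr ⟨x, subset_tsupport f h, rfl⟩)

/-- Compactness of the support makes local constancy uniform. By the ultrametric inequality the
least of finitely many local radii works throughout the support, and also for translations into or
out of it. -/
lemma exists_forall_add_eq {f : K → ℂ} (hf : IsLocallyConstant f) (hc : HasCompactSupport f) :
    ∃ r : ℝ, 0 < r ∧ ∀ x h : K, normAbs h ≤ r → f (x + h) = f x := by
  have hloc : ∀ x : K, ∃ r : ℝ, 0 < r ∧ ∀ h, normAbs h ≤ r → f (x + h) = f x := by
    intro x
    have h1 : ∀ᶠ y in 𝓝 x, f y = f x := hf.eventually_eq x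
    have h2 : ∀ᶠ h in 𝓝 (0 : K), f (x + h) = f x := by
      have : Tendsto (fun h => x + h) (𝓝 (0 : K)) (𝓝 x) := by
        have : Continuous fun h : K => x + h := by fun_prop
        simpa using this.tendsto 0
      exact this.eventually h1
    obtain ⟨ε, hε, h3⟩ := (nhds_zero_hasBasis K).mem_iff.1 h2
    exact ⟨ε / 2, by positivity, fun h hh => h3 (by
      rw [Set.mem_ofPred_eq]; linarith)⟩
  choose r hr0 hr using hloc
  obtain ⟨t, -, ht⟩ := hc.isCompact.elim_nhds_subcover (fun x => {y | normAbs (y - x) ≤ r x}) (by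
    intro x _
    have : Continuous fun y : K => y - x := by fun_prop
    exact ((isOpen_normAbs_le (hr0 x)).preimage this).mem_nhds (by simpa using (hr0 x).le))
  obtain ⟨ρ, hρ0, hρ⟩ : ∃ ρ : ℝ, 0 < ρ ∧ ∀ x ∈ t, ρ ≤ r x := by
    rcases t.eq_empty_or_nonempty with rfl | hne
    · exact ⟨1, one_pos, by simp⟩
    · obtain ⟨x₀, hx₀, hmin⟩ := t.exists_min_image (fun x => r x) hne
      exact ⟨r x₀, hr0 _, hmin⟩
  have hsupp : ∀ x h : K, x ∈ tsupport f → normAbs h ≤ ρ → f (x + h) = f x := by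
    intro x h hx hh
    obtain ⟨x₀, hx₀, hxx⟩ := Set.mem_iUnion₂.1 (ht hx)
    have h1 := hr x₀ (x - x₀) hxx
    have h2 := hr x₀ (x - x₀ + h) (normAbs_add_le_of_le hxx (hh.trans (hρ _ hx₀)))
    rw [add_sub_cancel] at h1
    rw [h1, ← h2]
    congr 1; ring
  refine ⟨ρ, hρ0, fun x h hh => ?_⟩
  by_cases hx : x ∈ tsupport f
  · exact hsupp x h hx hh
  · by_cases hy : x + h ∈ tsupport f
    · have := hsupp (x + h) (-h) hy (by simpa)
      simpa using this.symm
    · rw [image_eq_zero_of_notMem_tsupport hx, image_eq_zero_of_notMem_tsupport hy]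

lemma measurable_fourier {f : K → ℂ} (hf : Measurable f) {ψ : AddChar K Circle} (hψ : Continuous ψ) :
    Measurable (fourier ψ μ f) := by
  have hc : Continuous fun p : K × K => (ψ (p.2 * p.1) : ℂ) :=
      continuous_circle_coe.comp (hψ.comp (by fun_prop))
  have : StronglyMeasurable fun p : K × K => f p.2 * (ψ (p.2 * p.1) : ℂ) :=
    ((hf.comp measurable_snd).mul hc.measurable).stronglyMeasurable
  exact this.integral_prod_right.measurable

/-- Boundedness is the `L¹` estimate. For bounded support, pick `x₀` with `ψ x₀ ≠ 1`: when `|y|` is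
large, translation by `x₀ / y` leaves `f` unchanged but multiplies the transform at `y` by `ψ x₀`.
-/
lemma isTame_fourier {f : K → ℂ} (hf : IsLocallyConstant f) (hc : HasCompactSupport f)
    {ψ : AddChar K Circle} (hψ : Continuous ψ) (hψ1 : ψ ≠ 1) : IsTame (fourier ψ μ f) := by
  have ht := isTame_of_isLocallyConstant hf hc
  refine ⟨measurable_fourier μ ht.measurable hψ, ⟨∫ x, ‖f x‖ ∂μ, fun y => ?_⟩, ?_⟩
  · refine (norm_integral_le_integral_norm _).trans (le_of_eq ?_)
    congr 1; ext x
    rw [norm_mul, Circle.norm_coe, mul_one]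
  · obtain ⟨r, hr0, hr⟩ := exists_forall_add_eq hf hc
    obtain ⟨x₀, hx₀⟩ : ∃ x₀, ψ x₀ ≠ 1 := by
      by_contra! h
      exact hψ1 (DFunLike.ext _ _ fun x => by rw [h x, AddChar.one_apply])
    refine ⟨normAbs x₀ / r, fun y hy => ?_⟩
    have hy0 : y ≠ 0 := by
      rintro rfl
      rw [normAbs_zero] at hy
      exact hy.not_ge (div_nonneg (normAbs_nonneg _) hr0.le)
    have hh : normAbs (x₀ / y) ≤ r := by
      rw [normAbs_div, div_le_iff₀ (normAbs_pos hy0)]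
      rw [div_lt_iff₀ hr0] at hy
      linarith
    have h1 : fourier ψ μ f y = (ψ x₀ : ℂ) * fourier ψ μ f y := by
      conv_lhs => rw [fourier, ← integral_add_right_eq_self _ (x₀ / y)]
      rw [fourier, ← integral_const_mul]
      congr 1; ext x
      rw [hr _ _ hh, add_mul, div_mul_cancel₀ _ hy0, AddChar.map_add_eq_mul, Circle.coe_mul]
      ring
    have h2 : ((ψ x₀ : ℂ) - 1) * fourier ψ μ f y = 0 := by
      rw [sub_mul, ← h1, one_mul, sub_self]
    rcases mul_eq_zero.1 h2 with h3 | h3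
    · exact absurd (Circle.ext (by simpa [sub_eq_zero] using h3)) hx₀
    · exact h3

/-- Evaluation of the constant of the local functional equation on a test function. -/
lemma epsilonStrip_eq {χ : Kˣ →ₜ* Circle} {ψ : AddChar K Circle} (hψ : Continuous ψ) (hψ1 : ψ ≠ 1)
    {s : ℝ} (hs0 : 0 < s) (hs1 : s < 1) {g : K → ℂ} (hg : IsLocallyConstant g)
    (hgc : HasCompactSupport g) {e : ℂ} (h0 : zetaIntegral μ g χ s * invLFactor χ s ≠ 0)
    (he : zetaIntegral μ (fourier ψ μ g) χ⁻¹ (1 - s) * invLFactor χ⁻¹ (1 - s) =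
      e * (zetaIntegral μ g χ s * invLFactor χ s)) :
    epsilonStrip χ ψ μ s = e := by
  have hsat : SatisfiesFunctionalEquation χ ψ μ s e := by
    intro f hf hfc
    have := zetaIntegral_fourier_symm (isTame_of_isLocallyConstant hf hfc)
      (isTame_of_isLocallyConstant hg hgc) hψ (isTame_fourier μ hf hfc hψ hψ1)
      (isTame_fourier μ hg hgc hψ hψ1) χ hs0 hs1
    have hz : zetaIntegral μ g χ s ≠ 0 := left_ne_zero_of_mul h0
    apply mul_left_cancel₀ hz
    rw [← mul_assoc, ← this, mul_assoc, he]
    ring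
  -- The chosen constant is only known to satisfy the functional equation. Testing it on `g`, where
  -- the zeta side is nonzero, forces it to equal `e`.
  have h1 := Classical.epsilon_spec (p := SatisfiesFunctionalEquation χ ψ μ s) ⟨e, hsat⟩
  have h2 := h1 g hg hgc
  rw [he] at h2
  exact (mul_right_cancel₀ h0 h2).symm

end FunctionalEquation

end LocalRoot

/-! ### Conductors of additive and multiplicative characters; Fourier transforms of balls. -/

namespace LocalRoot

/-- There are no nontrivial subgroups near `1`: squaring `z^n` multiplies its distance to `1` by
`|z^n + 1| ≥ 3/2`, so the distances would be unbounded. This turns continuity of a character into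
triviality on a small ball or on a group of higher units. -/
lemma eq_one_of_norm_pow_sub_one_le {z : ℂ} (h : ∀ n : ℕ, ‖z ^ n - 1‖ ≤ 1 / 2) : z = 1 := by
  have hstep : ∀ n : ℕ, (3 / 2 : ℝ) * ‖z ^ n - 1‖ ≤ ‖z ^ (n * 2) - 1‖ := by
    intro n
    have h1 : z ^ (n * 2) - 1 = (z ^ n + 1) * (z ^ n - 1) := by rw [pow_mul]; ring
    have h2 : (3 / 2 : ℝ) ≤ ‖z ^ n + 1‖ := by
      have h3 : (2 : ℝ) ≤ ‖z ^ n + 1‖ + ‖z ^ n - 1‖ := by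
        calc (2 : ℝ) = ‖(z ^ n + 1) - (z ^ n - 1)‖ := by
              rw [show (z ^ n + 1) - (z ^ n - 1) = 2 by ring]; simp
          _ ≤ _ := norm_sub_le _ _
      linarith [h n]
    rw [h1, norm_mul]
    exact mul_le_mul_of_nonneg_right h2 (norm_nonneg _)
  have hiter : ∀ k : ℕ, (3 / 2 : ℝ) ^ k * ‖z - 1‖ ≤ ‖z ^ (2 ^ k) - 1‖ := by
    intro k
    induction k with
    | zero => simp
    | succ k ih =>
      calc (3 / 2 : ℝ) ^ (k + 1) * ‖z - 1‖ = 3 / 2 * ((3 / 2) ^ k * ‖z - 1‖) := by ring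
        _ ≤ 3 / 2 * ‖z ^ (2 ^ k) - 1‖ := by gcongr
        _ ≤ _ := by rw [pow_succ]; exact hstep _
  by_contra hz
  have hpos : 0 < ‖z - 1‖ := norm_pos_iff.2 (sub_ne_zero.2 hz)
  obtain ⟨k, hk⟩ := pow_unbounded_of_one_lt (1 / ‖z - 1‖) (show (1 : ℝ) < 3 / 2 by norm_num)
  rw [div_lt_iff₀ hpos] at hk
  linarith [hiter k, h (2 ^ k)]

section RootNumbers

variable {K : Type*} [Field K] [ValuativeRel K] [TopologicalSpace K] [IsNonarchimedeanLocalField K]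

lemma exists_addChar_eq_one {ψ : AddChar K Circle} (hψ : Continuous ψ) :
    ∃ r : ℝ, 0 < r ∧ ∀ x, normAbs x ≤ r → ψ x = 1 := by
  have hc : Continuous fun x => ‖(ψ x : ℂ) - 1‖ :=
    ((continuous_circle_coe.comp hψ).sub continuous_const).norm
  have h1 : ∀ᶠ x in 𝓝 (0 : K), ‖(ψ x : ℂ) - 1‖ < 1 / 2 := by
    refine hc.continuousAt.eventually_lt_const ?_
    simp
  obtain ⟨ε, hε, h2⟩ := (nhds_zero_hasBasis K).mem_iff.1 h1
  refine ⟨ε / 2, by positivity, fun x hx => Circle.ext ?_⟩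
  refine eq_one_of_norm_pow_sub_one_le fun n => ?_
  have h3 : normAbs (n • x) ≤ ε / 2 := by
    induction n with
    | zero => rw [zero_smul, normAbs_zero]; positivity
    | succ n ih => rw [succ_nsmul]; exact normAbs_add_le_of_le ih hx
  have h4 : ‖(ψ (n • x) : ℂ) - 1‖ < 1 / 2 := h2 (show normAbs (n • x) < ε by linarith)
  rw [AddChar.map_nsmul_eq_pow, Circle.coe_pow] at h4
  exact h4.le

/-- `a` generates the inverse conductor of `ψ`: the largest fractional ideal `a 𝒪` on which the
additive character is trivial. -/
def IsConductorGenerator {K : Type*} [Field K] [ValuativeRel K] [TopologicalSpace K]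
    [IsNonarchimedeanLocalField K] (ψ : AddChar K Circle) (a : K) : Prop :=
  a ≠ 0 ∧ (∀ x : K, normAbs x ≤ normAbs a → ψ x = 1) ∧
    ∀ y : K, normAbs a < normAbs y → ∃ x : K, normAbs x ≤ normAbs y ∧ ψ x ≠ 1

lemma exists_isConductorGenerator {ψ : AddChar K Circle} (hψ : Continuous ψ) (hψ1 : ψ ≠ 1) :
    ∃ a, IsConductorGenerator ψ a := by
  obtain ⟨ϖ, h⟩ := exists_isUniformizer K
  obtain ⟨x₀, hx₀⟩ : ∃ x₀, ψ x₀ ≠ 1 := by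
    by_contra! h
    exact hψ1 (DFunLike.ext _ _ fun x => by rw [h x, AddChar.one_apply])
  have hx0 : x₀ ≠ 0 := by rintro rfl; simp at hx₀
  obtain ⟨r, hr0, hr⟩ := exists_addChar_eq_one hψ
  -- The balls `ϖ^n x₀ 𝒪` decrease, and the first one on which `ψ` is trivial is the required ideal.
  -- It is not the ball `n = 0`, since `ψ x₀ ≠ 1`, so the preceding ball exists and witnesses
  -- maximality.
  have hex : ∃ n : ℕ, ∀ x, normAbs x ≤ normAbs (ϖ ^ n * x₀) → ψ x = 1 := by
    obtain ⟨n, hn⟩ := exists_pow_lt_of_lt_one (div_pos hr0 (normAbs_pos hx0)) h.normAbs_lt_one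
    refine ⟨n, fun x hx => hr x (hx.trans ?_)⟩
    rw [lt_div_iff₀ (normAbs_pos hx0)] at hn
    simpa using hn.le
  classical
  have hspec := Nat.find_spec hex
  have hmin := fun m => Nat.find_min hex (m := m)
  set n := Nat.find hex
  have hn : n ≠ 0 := by
    intro h0
    rw [h0] at hspec
    exact hx₀ (hspec x₀ (by simp))
  refine ⟨ϖ ^ n * x₀, mul_ne_zero (pow_ne_zero _ h.ne_zero) hx0, hspec, fun y hy => ?_⟩
  have hm := hmin (n - 1) (by omega)
  push Not at hm
  obtain ⟨x, hx, hx1⟩ := hm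
  refine ⟨x, hx.trans ?_, hx1⟩
  have hy0 : y ≠ 0 := by
    rintro rfl
    rw [normAbs_zero] at hy
    exact (normAbs_nonneg _).not_gt hy
  have := (normAbs_le_mul_iff_lt h hy0).2 hy
  have hpow : ϖ ^ n = ϖ * ϖ ^ (n - 1) := by rw [← pow_succ']; congr 1; omega
  rw [hpow, mul_assoc, normAbs_mul] at this
  exact le_of_mul_le_mul_left this h.normAbs_pos

lemma higherUnits_pow {n : ℕ} {u : Kˣ} (hu : u ∈ higherUnits K n) (k : ℕ) : u ^ k ∈ higherUnits K n := by
  obtain ⟨ϖ, h⟩ := exists_isUniformizer K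
  rw [mem_higherUnits_iff h] at hu ⊢
  refine ⟨by simp [hu.1], ?_⟩
  induction k with
  | zero => simpa using pow_nonneg h.normAbs_pos.le n
  | succ k ih =>
    have : ((u ^ (k + 1) : Kˣ) : K) - 1 = (u : K) * (((u ^ k : Kˣ) : K) - 1) + ((u : K) - 1) := by
      push_cast; ring
    rw [this]
    exact normAbs_add_le_of_le (by simpa [hu.1] using ih) hu.2

/-- This makes the infimum defining `conductorExponent` an attained minimum rather than the default
value of an empty infimum. -/
lemma exists_trivial_on_higherUnits (χ : Kˣ →ₜ* Circle) : ∃ n, ∀ u ∈ higherUnits K n, χ u = 1 := by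
  obtain ⟨ϖ, h⟩ := exists_isUniformizer K
  have hc : Continuous fun u : Kˣ => ‖(χ u : ℂ) - 1‖ :=
    ((continuous_circle_coe.comp χ.continuous_toFun).sub continuous_const).norm
  have h1 : ∀ᶠ u in 𝓝 (1 : Kˣ), ‖(χ u : ℂ) - 1‖ < 1 / 2 :=
    hc.continuousAt.eventually_lt_const (by simp)
  rw [Units.isEmbedding_val₀.isInducing.nhds_eq_comap, eventually_comap] at h1
  have h2 : Tendsto (fun x : K => x + 1) (𝓝 0) (𝓝 ((1 : Kˣ) : K)) := by
    have : Continuous fun x : K => x + 1 := by fun_prop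
    simpa using this.tendsto 0
  obtain ⟨ε, hε, h3⟩ := (nhds_zero_hasBasis K).mem_iff.1 (h2.eventually h1)
  obtain ⟨n, hn⟩ := exists_pow_lt_of_lt_one hε h.normAbs_lt_one
  refine ⟨n, fun u hu => Circle.ext (eq_one_of_norm_pow_sub_one_le fun k => ?_)⟩
  have hk := (mem_higherUnits_iff h n).1 (higherUnits_pow hu k)
  have h4 := h3 (show normAbs (((u ^ k : Kˣ) : K) - 1) < ε from hk.2.trans_lt hn) (u ^ k) (by simp)
  rw [map_pow, Circle.coe_pow] at h4
  exact h4.le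

lemma eq_one_of_mem_higherUnits_conductorExponent (χ : Kˣ →ₜ* Circle) {u : Kˣ}
    (hu : u ∈ higherUnits K (conductorExponent χ)) : χ u = 1 :=
  Nat.sInf_mem (s := {n : ℕ | ∀ u ∈ higherUnits K n, χ u = 1}) (exists_trivial_on_higherUnits χ) u hu

lemma conductorExponent_pos {χ : Kˣ →ₜ* Circle} (hχ : ¬ IsUnramifiedChar χ) :
    1 ≤ conductorExponent χ := by
  obtain ⟨ϖ, h⟩ := exists_isUniformizer K
  by_contra! h0
  refine hχ fun u hu => eq_one_of_mem_higherUnits_conductorExponent χ ?_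
  rw [mem_higherUnits_iff h, show conductorExponent χ = 0 by omega, pow_zero]
  have := mem_unitGroup_iff.1 hu
  exact ⟨this, normAbs_sub_le_of_le this.le (by simp)⟩

lemma exists_ne_one_of_lt_conductorExponent {χ : Kˣ →ₜ* Circle} {n : ℕ} (hn : n < conductorExponent χ) :
    ∃ u ∈ higherUnits K n, χ u ≠ 1 := by
  have := Nat.notMem_of_lt_sInf hn
  simpa using this

variable [MeasurableSpace K] [BorelSpace K] {μ : Measure K} [μ.IsAddHaarMeasure]

lemma epsilonFactor_eq_of_tendsto {χ : Kˣ →ₜ* Circle} {ψ : AddChar K Circle} {E : ℝ → ℂ} {e : ℂ}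
    (h : ∀ s, 0 < s → s < 1 → epsilonStrip χ ψ μ s = E s) (hE : Tendsto E (𝓝 0) (𝓝 e)) :
    epsilonFactor χ ψ μ = e := by
  refine Tendsto.limUnder_eq ((hE.mono_left nhdsWithin_le_nhds).congr' ?_)
  filter_upwards [Ioo_mem_nhdsGT (zero_lt_one' ℝ)] with s hs
  exact (h s hs.1 hs.2).symm

lemma zetaIntegral_comp_mul {c : K} (hc : c ≠ 0) (f : K → ℂ) (χ : Kˣ →ₜ* Circle) (s : ℝ) :
    zetaIntegral μ (fun x => f (c⁻¹ * x)) χ s =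
      charExt χ c * ((normAbs c ^ s : ℝ) : ℂ) * zetaIntegral μ f χ s := by
  rw [zetaIntegral_eq, zetaIntegral_eq, integral_eq_mul_integral_comp μ hc, ← integral_const_mul,
    ← integral_const_mul]
  congr 1; ext x
  rw [inv_mul_cancel_left₀ hc, charExt_mul, normAbs_mul, Real.mul_rpow (normAbs_nonneg _) (normAbs_nonneg _),
    Real.rpow_sub_one (normAbs_ne_zero hc)]
  have : (normAbs c : ℂ) ≠ 0 := by exact_mod_cast normAbs_ne_zero hc
  push_cast
  field_simp

lemma zetaIntegral_add {f g : K → ℂ} (hf : IsTame f) (hg : IsTame g) (χ : Kˣ →ₜ* Circle) {s : ℝ}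
    (hs : 0 < s) : zetaIntegral μ (fun x => f x + g x) χ s = zetaIntegral μ f χ s + zetaIntegral μ g χ s := by
  simp only [zetaIntegral_eq]
  rw [← integral_add (hf.integrable_zeta μ χ hs) (hg.integrable_zeta μ χ hs)]
  congr 1; ext x
  ring

lemma zetaIntegral_const_mul (c : ℂ) (f : K → ℂ) (χ : Kˣ →ₜ* Circle) (s : ℝ) :
    zetaIntegral μ (fun x => c * f x) χ s = c * zetaIntegral μ f χ s := by
  simp only [zetaIntegral_eq]
  rw [← integral_const_mul]
  congr 1; ext x
  ring

lemma isTame_indicator {S : Set K} (hS : MeasurableSet S) {r : ℝ} (h : ∀ x ∈ S, normAbs x ≤ r) :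
    IsTame (S.indicator (1 : K → ℂ)) := by
  refine ⟨measurable_one.indicator hS, ⟨1, fun x => ?_⟩, ⟨r, fun x hx => ?_⟩⟩
  · by_cases hx : x ∈ S <;> simp [hx]
  · rw [Set.indicator_of_notMem]
    exact fun hxS => hx.not_ge (h x hxS)

lemma integral_indicator_one_complex {S : Set K} (hS : MeasurableSet S) :
    ∫ x, S.indicator (1 : K → ℂ) x ∂μ = (μ.real S : ℂ) := by
  rw [integral_indicator hS]
  simp

lemma isLocallyConstant_indicator {X : Type*} [TopologicalSpace X] {S : Set X} (hS : IsClopen S) :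
    IsLocallyConstant (S.indicator (1 : X → ℂ)) := by
  rw [← LocallyConstant.coe_charFn ℂ hS]
  exact (LocallyConstant.charFn ℂ hS).isLocallyConstant

lemma isClopen_normAbs_sub_le (a : K) {r : ℝ} (hr : 0 < r) : IsClopen {x : K | normAbs (x - a) ≤ r} := by
  have hc : Continuous fun y : K => y - a := by fun_prop
  exact ⟨isClosed_le (continuous_normAbs.comp hc) continuous_const, (isOpen_normAbs_le hr).preimage hc⟩

lemma hasCompactSupport_indicator_normAbs_sub_le (a : K) (r : ℝ) :
    HasCompactSupport ({x : K | normAbs (x - a) ≤ r}.indicator (1 : K → ℂ)) := by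
  refine HasCompactSupport.intro ((isCompact_normAbs_le r).image (f := fun x => x + a) (by fun_prop))
    fun x hx => Set.indicator_of_notMem (fun hx' => hx ⟨x - a, ?_⟩) _
  exact ⟨hx', by simp⟩

/-- The Fourier transform of the characteristic function of a ball. -/
lemma fourier_indicator_ball {ψ : AddChar K Circle} {a : K} (ha : IsConductorGenerator ψ a)
    (b : K) {c : K} (hc : c ≠ 0) (y : K) :
    fourier ψ μ ({x : K | normAbs (x - b) ≤ normAbs c}.indicator 1) y =
      (ψ (b * y) : ℂ) * ((μ.real {x : K | normAbs x ≤ normAbs c} : ℂ) *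
        {y : K | normAbs y ≤ normAbs (a / c)}.indicator 1 y) := by
  have h1 : fourier ψ μ ({x : K | normAbs (x - b) ≤ normAbs c}.indicator 1) y =
      (ψ (b * y) : ℂ) * fourier ψ μ ({x : K | normAbs x ≤ normAbs c}.indicator 1) y := by
    rw [fourier, ← integral_add_right_eq_self _ b, fourier, ← integral_const_mul]
    congr 1; ext x
    rw [add_mul, AddChar.map_add_eq_mul, Circle.coe_mul]
    simp only [Set.indicator_apply, Set.mem_ofPred_eq, add_sub_cancel_right, Pi.one_apply]
    ring
  rw [h1]
  congr 1
  by_cases hy : normAbs y ≤ normAbs (a / c)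
  · rw [Set.indicator_of_mem (by exact hy), Pi.one_apply, mul_one, fourier]
    have : ∀ x, {x : K | normAbs x ≤ normAbs c}.indicator (1 : K → ℂ) x * (ψ (x * y) : ℂ) =
        {x : K | normAbs x ≤ normAbs c}.indicator (1 : K → ℂ) x := by
      intro x
      by_cases hx : normAbs x ≤ normAbs c
      · rw [ha.2.1 (x * y), Circle.coe_one, mul_one]
        rw [normAbs_mul]
        rw [normAbs_div, le_div_iff₀ (normAbs_pos hc)] at hy
        calc _ ≤ normAbs c * normAbs y := mul_le_mul_of_nonneg_right hx (normAbs_nonneg _)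
          _ ≤ _ := by rwa [mul_comm]
      · rw [Set.indicator_of_notMem (by exact hx), zero_mul]
    simp only [this]
    rw [integral_indicator_one_complex (measurableSet_normAbs_le _)]
  · rw [Set.indicator_of_notMem (by exact hy), mul_zero]
    -- Outside the dual ball, `ψ` is nontrivial on `c y 𝒪`, say at `t`. Translating the ball by `t /
    -- y` then multiplies the transform by `ψ t ≠ 1`, so it vanishes.
    have hy' : normAbs a < normAbs (c * y) := by
      rw [not_le, normAbs_div, div_lt_iff₀ (normAbs_pos hc)] at hy
      rwa [normAbs_mul, mul_comm]
    obtain ⟨t, ht, ht1⟩ := ha.2.2 _ hy'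
    have hy0 : y ≠ 0 := by
      rintro rfl
      simp [(normAbs_nonneg a).not_gt] at hy'
    have hty : normAbs (t / y) ≤ normAbs c := by
      rw [normAbs_div, div_le_iff₀ (normAbs_pos hy0)]
      simpa using ht
    have h2 : fourier ψ μ ({x : K | normAbs x ≤ normAbs c}.indicator 1) y =
        (ψ t : ℂ) * fourier ψ μ ({x : K | normAbs x ≤ normAbs c}.indicator 1) y := by
      conv_lhs => rw [fourier, ← integral_add_right_eq_self _ (t / y)]
      rw [fourier, ← integral_const_mul]
      congr 1; ext x
      have : normAbs (x + t / y) ≤ normAbs c ↔ normAbs x ≤ normAbs c :=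
        ⟨fun h => by simpa using normAbs_sub_le_of_le h hty, fun h => normAbs_add_le_of_le h hty⟩
      rw [add_mul, div_mul_cancel₀ _ hy0, AddChar.map_add_eq_mul, Circle.coe_mul]
      simp only [Set.indicator_apply, Set.mem_ofPred_eq, this, Pi.one_apply]
      ring
    have h3 : ((ψ t : ℂ) - 1) * fourier ψ μ ({x : K | normAbs x ≤ normAbs c}.indicator 1) y = 0 := by
      rw [sub_mul, ← h2, one_mul, sub_self]
    rcases mul_eq_zero.1 h3 with h4 | h4
    · exact absurd (Circle.ext (by simpa [sub_eq_zero] using h4)) ht1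
    · exact h4

end RootNumbers

end LocalRoot

namespace LocalRoot

/-! ### Root numbers of unramified and ramified characters. -/

section RootNumbers

variable {K : Type*} [Field K] [ValuativeRel K] [TopologicalSpace K] [IsNonarchimedeanLocalField K]
variable [MeasurableSpace K] [BorelSpace K] {μ : Measure K} [μ.IsAddHaarMeasure]

lemma measurableSet_normAbs_eq (r : ℝ) : MeasurableSet {x : K | normAbs x = r} :=
  measurableSet_eq_fun continuous_normAbs.measurable measurable_const

lemma isTame_indicator_le (r : ℝ) : IsTame ({x : K | normAbs x ≤ r}.indicator 1) :=
  isTame_indicator (measurableSet_normAbs_le r) fun _ h => h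

lemma isTame_indicator_eq (r : ℝ) : IsTame ({x : K | normAbs x = r}.indicator 1) :=
  isTame_indicator (r := r) (measurableSet_normAbs_eq r) fun _ h => le_of_eq h

lemma measureReal_normAbs_le_pos {r : ℝ} (hr : 0 < r) : 0 < μ.real {x : K | normAbs x ≤ r} :=
  ENNReal.toReal_pos (measure_normAbs_le_pos μ hr).ne' (measure_normAbs_le_lt_top μ r).ne

lemma indicator_ball_eq_sphere_add {ϖ : K} (h : IsUniformizer ϖ) {b : K} (hb : b ≠ 0) (x : K) :
    {x : K | normAbs x ≤ normAbs b}.indicator (1 : K → ℂ) x =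
      {x : K | normAbs x = normAbs b}.indicator 1 x +
        {x : K | normAbs x ≤ normAbs (ϖ * b)}.indicator 1 x := by
  simp only [Set.indicator_apply, Set.mem_ofPred_eq, normAbs_mul, normAbs_le_mul_iff_lt h hb, Pi.one_apply]
  rcases lt_trichotomy (normAbs x) (normAbs b) with h1 | h1 | h1
  · simp [h1.le, h1.ne, h1]
  · simp [h1]
  · simp [h1.not_ge, h1.ne', h1.not_gt]

lemma measureReal_ball_uniformizer {ϖ : K} (h : IsUniformizer ϖ) :
    μ.real {x : K | normAbs x ≤ normAbs ϖ} = normAbs ϖ * μ.real {x : K | normAbs x ≤ 1} := by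
  have h1 := residueCard_mul_measure μ h
  have h2 := congrArg ENNReal.toReal h1
  rw [ENNReal.toReal_mul, ENNReal.toReal_natCast] at h2
  rw [Measure.real, Measure.real, ← h2, h.normAbs_eq, inv_mul_cancel_left₀ (residueCard_pos K).ne']

lemma measureReal_sphere {ϖ : K} (h : IsUniformizer ϖ) :
    μ.real {x : K | normAbs x = 1} = (1 - normAbs ϖ) * μ.real {x : K | normAbs x ≤ 1} := by
  have h1 : {x : K | normAbs x = 1} = {x : K | normAbs x ≤ 1} \ {x : K | normAbs x ≤ normAbs ϖ} := by
    ext x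
    have := normAbs_le_mul_iff_lt h (x := x) (y := 1) one_ne_zero
    simp only [normAbs_one, mul_one] at this
    simp only [Set.mem_ofPred_eq, Set.mem_sdiff, this, not_lt, le_antisymm_iff]
  rw [h1, measureReal_sdiff _ (measurableSet_normAbs_le _) (measure_normAbs_le_lt_top μ _).ne,
    measureReal_ball_uniformizer h]
  · ring
  · intro x hx
    rw [Set.mem_ofPred_eq] at hx ⊢
    exact hx.trans h.normAbs_lt_one.le

lemma measureReal_sphere_pos : 0 < μ.real {x : K | normAbs x = 1} := by
  obtain ⟨ϖ, h⟩ := exists_isUniformizer K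
  rw [measureReal_sphere h]
  exact mul_pos (sub_pos.2 h.normAbs_lt_one) (measureReal_normAbs_le_pos one_pos)

lemma IsUnramifiedChar.charExt_eq_one {χ : Kˣ →ₜ* Circle} (hχ : IsUnramifiedChar χ) {x : K}
    (hx : normAbs x = 1) : charExt χ x = 1 := by
  have hx0 : x ≠ 0 := by rintro rfl; simp at hx
  rw [charExt_of_ne_zero χ hx0, hχ _ (mem_unitGroup_iff.2 hx), Circle.coe_one]

lemma charExt_inv (χ : Kˣ →ₜ* Circle) (x : K) : charExt χ⁻¹ x = (charExt χ x)⁻¹ := by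
  by_cases hx : x = 0
  · simp [hx]
  · exact eq_inv_of_mul_eq_one_left (charExt_inv_mul_cancel χ hx)

lemma IsUnramifiedChar.inv {χ : Kˣ →ₜ* Circle} (hχ : IsUnramifiedChar χ) : IsUnramifiedChar χ⁻¹ :=
  fun u hu => by
    change (χ u)⁻¹ = 1
    rw [hχ u hu, inv_one]

/-- The normalized zeta integral of the characteristic function of the ring of integers. -/
lemma zetaIntegral_integers {χ : Kˣ →ₜ* Circle} (hχ : IsUnramifiedChar χ) {s : ℝ} (hs : 0 < s) :
    zetaIntegral μ ({x : K | normAbs x ≤ 1}.indicator 1) χ s * invLFactor χ s =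
      μ.real {x : K | normAbs x = 1} := by
  have h := isUniformizer_uniformizer K
  set ϖ : K := (uniformizer K : K) with hϖ
  set f : K → ℂ := {x : K | normAbs x ≤ 1}.indicator 1 with hf
  -- Self-similarity of `𝒪`, the disjoint union of `U` and `ϖ 𝒪`: the zeta integral satisfies `Z =
  -- vol(U) + χ(ϖ)|ϖ|^s Z`, which replaces summing a geometric series.
  have h1 : f = fun x => {x : K | normAbs x = 1}.indicator (1 : K → ℂ) x + f (ϖ⁻¹ * x) := by
    ext x
    have := indicator_ball_eq_sphere_add h one_ne_zero x
    rw [normAbs_one] at this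
    rw [hf, this]
    congr 1
    simp only [Set.indicator_apply, Set.mem_ofPred_eq, normAbs_mul, mul_one,
      normAbs_inv, Pi.one_apply, inv_mul_le_iff₀ h.normAbs_pos]
  have h2 : IsTame fun x => f (ϖ⁻¹ * x) := by
    have : (fun x => f (ϖ⁻¹ * x)) = {x : K | normAbs x ≤ normAbs ϖ}.indicator 1 := by
      ext x
      simp only [hf, Set.indicator_apply, Set.mem_ofPred_eq, normAbs_mul, normAbs_inv, Pi.one_apply,
        inv_mul_le_iff₀ h.normAbs_pos, mul_one]
    rw [this]
    exact isTame_indicator_le _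
  have h3 : zetaIntegral μ f χ s = μ.real {x : K | normAbs x = 1} +
      charExt χ ϖ * ((normAbs ϖ ^ s : ℝ) : ℂ) * zetaIntegral μ f χ s := by
    conv_lhs => rw [h1, zetaIntegral_add (isTame_indicator_eq 1) h2 χ hs,
      zetaIntegral_comp_mul h.ne_zero]
    congr 1
    rw [← integral_indicator_one_complex (measurableSet_normAbs_eq 1), zetaIntegral_eq]
    congr 1; ext x
    by_cases hx : normAbs x = 1
    · rw [hχ.charExt_eq_one hx, hx]; simp
    · rw [Set.indicator_of_notMem (by exact hx)]; simp
  rw [invLFactor, if_pos hχ, Real.rpow_neg (residueCard_pos K).le, ← Real.inv_rpow (residueCard_pos K).le,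
    ← h.normAbs_eq, ← charExt_units, ← hϖ]
  linear_combination h3

/-- The root number of an unramified character. -/
theorem rootNumber_of_isUnramifiedChar {χ : Kˣ →ₜ* Circle} (hχ : IsUnramifiedChar χ)
    {ψ : AddChar K Circle} (hψ : Continuous ψ) (hψ1 : ψ ≠ 1) {a : K} (ha : IsConductorGenerator ψ a) :
    rootNumber χ ψ μ = charExt χ⁻¹ a := by
  set m := μ.real {x : K | normAbs x ≤ 1} with hm
  have hm0 : 0 < m := measureReal_normAbs_le_pos one_pos
  have heps : epsilonFactor χ ψ μ = (m * normAbs a : ℝ) * charExt χ⁻¹ a := by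
    refine epsilonFactor_eq_of_tendsto
      (E := fun s => (m : ℂ) * (charExt χ⁻¹ a * ((normAbs a ^ (1 - s) : ℝ) : ℂ))) ?_ ?_
    · intro s hs0 hs1
      have hball : {x : K | normAbs (x - 0) ≤ 1} = {x : K | normAbs x ≤ 1} := by simp
      -- The transform of `1_𝒪` is `m` times the indicator of `a 𝒪`, so both zeta integrals reduce
      -- to `vol(U)` and the constant is `m χ⁻¹(a) |a|^(1-s)`.
      have hfour : fourier ψ μ ({x : K | normAbs x ≤ 1}.indicator 1) =
          fun y => (m : ℂ) * {x : K | normAbs x ≤ 1}.indicator 1 (a⁻¹ * y) := by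
        ext y
        have := fourier_indicator_ball (μ := μ) ha 0 one_ne_zero y
        rw [normAbs_one, hball] at this
        rw [this]
        simp only [zero_mul, AddChar.map_zero_eq_one, Circle.coe_one, one_mul, Set.indicator_apply,
          Set.mem_ofPred_eq, normAbs_mul, normAbs_inv, Pi.one_apply,
          inv_mul_le_iff₀ (normAbs_pos ha.1), mul_one, div_one]
        rfl
      refine epsilonStrip_eq μ hψ hψ1 hs0 hs1 (g := {x : K | normAbs x ≤ 1}.indicator 1) ?_ ?_ ?_ ?_
      · have := isClopen_normAbs_sub_le (0 : K) one_pos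
        rw [hball] at this
        exact isLocallyConstant_indicator this
      · have := hasCompactSupport_indicator_normAbs_sub_le (0 : K) 1
        rwa [hball] at this
      · rw [zetaIntegral_integers hχ hs0]
        exact_mod_cast measureReal_sphere_pos.ne'
      · rw [zetaIntegral_integers hχ hs0, hfour, zetaIntegral_const_mul, zetaIntegral_comp_mul ha.1,
          mul_assoc, mul_assoc (charExt _ _ * _), zetaIntegral_integers hχ.inv (by linarith)]
        ring
    · have h1 : Tendsto (fun s : ℝ => normAbs a ^ (1 - s)) (𝓝 0) (𝓝 (normAbs a)) := by
        have hc : Continuous fun s : ℝ => normAbs a ^ (1 - s) :=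
          Continuous.rpow (by fun_prop) (by fun_prop) fun _ => Or.inl (normAbs_ne_zero ha.1)
        simpa using hc.tendsto 0
      have h2 := (Complex.continuous_ofReal.tendsto _).comp h1
      have h3 := (h2.const_mul (charExt χ⁻¹ a)).const_mul (m : ℂ)
      refine h3.congr' (Eventually.of_forall fun s => rfl) |>.trans (le_of_eq ?_)
      congr 1
      push_cast
      ring
  rw [rootNumber, heps, norm_mul, norm_charExt_of_ne_zero _ ha.1, mul_one, Complex.norm_real,
    Real.norm_of_nonneg (mul_nonneg hm0.le (normAbs_nonneg _)), mul_div_assoc, mul_comm]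
  have : ((m * normAbs a : ℝ) : ℂ) ≠ 0 := by
    exact_mod_cast (mul_pos hm0 (normAbs_pos ha.1)).ne'
  field_simp

/-- The epsilon factor of a ramified character as a Gauss integral. -/
theorem epsilonFactor_of_not_isUnramifiedChar {χ : Kˣ →ₜ* Circle} (hχ : ¬ IsUnramifiedChar χ)
    {ψ : AddChar K Circle} (hψ : Continuous ψ) (hψ1 : ψ ≠ 1) {a : K} (ha : IsConductorGenerator ψ a)
    {ϖ : K} (h : IsUniformizer ϖ) {b : K} (hb : b = a / ϖ ^ conductorExponent χ) :
    epsilonFactor χ ψ μ = (normAbs b : ℂ) * charExt χ⁻¹ b *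
      ∫ z, {z : K | normAbs z = 1}.indicator 1 z * charExt χ⁻¹ z * (ψ (b * z) : ℂ) ∂μ := by
  set f := conductorExponent χ with hf
  have hf1 : 1 ≤ f := conductorExponent_pos hχ
  have hc0 : ϖ ^ f ≠ 0 := pow_ne_zero _ h.ne_zero
  have hb0 : b ≠ 0 := by rw [hb]; exact div_ne_zero ha.1 hc0
  have hχ' : ¬ IsUnramifiedChar χ⁻¹ := fun h' => hχ (by simpa using h'.inv)
  set m := μ.real {x : K | normAbs x ≤ normAbs (ϖ ^ f)} with hm
  have hm0 : 0 < m := measureReal_normAbs_le_pos (normAbs_pos hc0)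
  set T := ∫ y, {y : K | normAbs y = normAbs b}.indicator 1 y * charExt χ⁻¹ y * (ψ y : ℂ) ∂μ with hT
  have heps : epsilonFactor χ ψ μ = T := by
    refine epsilonFactor_eq_of_tendsto (E := fun s => ((normAbs b ^ (-s) : ℝ) : ℂ) * T) ?_ ?_
    · intro s hs0 hs1
      -- On the support `1 + 𝔪^f` both `χ` and `|·|` equal `1` (here `f ≥ 1` is used), so the zeta
      -- integral of `g` is the volume `m`, independently of `s`.
      set g : K → ℂ := {x : K | normAbs (x - 1) ≤ normAbs (ϖ ^ f)}.indicator 1 with hg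
      have hg1 : ∀ x : K, normAbs (x - 1) ≤ normAbs (ϖ ^ f) → normAbs x = 1 := by
        intro x hx
        have hlt : normAbs (x - 1) < normAbs (1 : K) := by
          refine hx.trans_lt ?_
          rw [normAbs_pow, normAbs_one]
          exact pow_lt_one₀ h.normAbs_pos.le h.normAbs_lt_one (by omega)
        simpa using normAbs_add_eq_of_lt hlt
      have hzg : zetaIntegral μ g χ s = m := by
        have h1 : ∀ x, g x * charExt χ x * ((normAbs x ^ (s - 1) : ℝ) : ℂ) = g x := by
          intro x
          by_cases hx : normAbs (x - 1) ≤ normAbs (ϖ ^ f)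
          · have hx1 := hg1 x hx
            have hx0 : x ≠ 0 := by rintro rfl; simp at hx1
            have : charExt χ x = 1 := by
              rw [charExt_of_ne_zero χ hx0, eq_one_of_mem_higherUnits_conductorExponent χ,
                Circle.coe_one]
              rw [mem_higherUnits_iff h]
              exact ⟨hx1, by simpa using hx⟩
            rw [this, hx1]; simp
          · simp only [hg]
            rw [Set.indicator_of_notMem (by exact hx)]; simp
        rw [zetaIntegral_eq]
        simp only [h1]
        rw [← integral_add_right_eq_self _ 1, hm,
          ← integral_indicator_one_complex (measurableSet_normAbs_le _)]
        congr 1; ext x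
        simp [hg, Set.indicator_apply]
      have hfour : fourier ψ μ g = fun y => (m : ℂ) *
          ({y : K | normAbs y ≤ normAbs b}.indicator 1 y * (ψ y : ℂ)) := by
        ext y
        rw [hg, fourier_indicator_ball ha 1 hc0, ← hb, one_mul]
        ring
      have hψt : ∀ S : Set K, MeasurableSet S → (∀ x ∈ S, normAbs x ≤ normAbs b) →
          IsTame fun y => S.indicator 1 y * (ψ y : ℂ) := by
        intro S hS hSb
        have ht := isTame_indicator hS hSb
        refine ⟨ht.measurable.mul (continuous_circle_coe.comp hψ).measurable, ?_, ?_⟩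
        · obtain ⟨C, hC⟩ := ht.bounded
          exact ⟨C, fun x => by rw [norm_mul, Circle.norm_coe, mul_one]; exact hC x⟩
        · obtain ⟨r, hr⟩ := ht.support
          exact ⟨r, fun x hx => by simp only [hr x hx, zero_mul]⟩
      -- Minimality of `f` gives `u` in `1 + 𝔪^(f-1)` with `χ u ≠ 1`. For `|y| ≤ |ϖ b|` the element
      -- `(u - 1) y` lies in `a 𝒪`, so `ψ(uy) = ψ(y)`: scaling by `u` preserves the integrand apart
      -- from the factor `χ⁻¹(u)`.
      obtain ⟨u, hu, hu1⟩ := exists_ne_one_of_lt_conductorExponent (χ := χ) (n := f - 1) (by omega)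
      rw [mem_higherUnits_iff h] at hu
      -- the integral over the smaller ball vanishes
      have hvan : zetaIntegral μ (fun y => {y : K | normAbs y ≤ normAbs (ϖ * b)}.indicator 1 y *
          (ψ y : ℂ)) χ⁻¹ (1 - s) = 0 := by
        set F : K → ℂ := fun y => {y : K | normAbs y ≤ normAbs (ϖ * b)}.indicator 1 y * (ψ y : ℂ)
          with hF
        have hinv : (fun y => F ((u : K)⁻¹ * y)) = F := by
          have : ∀ y, F ((u : K) * y) = F y := by
            intro y
            simp only [hF, Set.indicator_apply, Set.mem_ofPred_eq, normAbs_mul, hu.1, one_mul,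
              Pi.one_apply]
            split_ifs with hy
            · have : (u : K) * y = ((u : K) - 1) * y + y := by ring
              have hψu : ψ (((u : K) - 1) * y) = 1 := by
                refine ha.2.1 _ ?_
                have hab : normAbs a = normAbs ϖ ^ (f - 1) * (normAbs ϖ * normAbs b) := by
                  rw [← mul_assoc, pow_sub_one_mul (by omega), hb, normAbs_div, normAbs_pow,
                    mul_div_cancel₀ _ (pow_ne_zero _ h.normAbs_pos.ne')]
                rw [hab, normAbs_mul]
                exact mul_le_mul hu.2 hy (normAbs_nonneg _) (pow_nonneg h.normAbs_pos.le _)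
              rw [this, AddChar.map_add_eq_mul, hψu, one_mul (ψ y)]
            · simp
          ext y
          rw [← this, mul_inv_cancel_left₀ u.ne_zero]
        have h1 := zetaIntegral_comp_mul (μ := μ) u.ne_zero F χ⁻¹ (1 - s)
        rw [hinv, hu.1, Real.one_rpow, Complex.ofReal_one, mul_one, charExt_units] at h1
        have h2 : (1 - (χ⁻¹ u : ℂ)) * zetaIntegral μ F χ⁻¹ (1 - s) = 0 := by
          rw [sub_mul, ← h1, one_mul, sub_self]
        rcases mul_eq_zero.1 h2 with h3 | h3
        · have h4 : χ⁻¹ u = 1 := Circle.ext (by rw [Circle.coe_one]; exact (sub_eq_zero.1 h3).symm)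
          exact absurd (inv_eq_one.1 (show (χ u)⁻¹ = 1 from h4)) hu1
        · exact h3
      -- Only the sphere `|y| = |b|` survives. There `|y|^(-s)` is constant, so all dependence on
      -- `s` leaves the integral and tends to `1` as `s → 0`.
      have hZ : zetaIntegral μ (fourier ψ μ g) χ⁻¹ (1 - s) = m * (((normAbs b ^ (-s) : ℝ) : ℂ) * T) := by
        rw [hfour, zetaIntegral_const_mul]
        congr 1
        simp only [indicator_ball_eq_sphere_add h hb0, add_mul]
        rw [zetaIntegral_add (hψt _ (measurableSet_normAbs_eq _) fun x hx => le_of_eq hx)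
          (hψt _ (measurableSet_normAbs_le _) fun x hx => ?_) _ (by linarith), hvan, add_zero,
          zetaIntegral_eq, hT, ← integral_const_mul]
        · congr 1; ext y
          by_cases hy : normAbs y = normAbs b
          · rw [hy]
            ring_nf
          · rw [Set.indicator_of_notMem (by exact hy)]; simp
        · rw [Set.mem_ofPred_eq] at hx
          refine hx.trans ?_
          rw [normAbs_mul]
          exact mul_le_of_le_one_left (normAbs_nonneg _) h.normAbs_lt_one.le
      have hL : invLFactor χ s = 1 := by rw [invLFactor, if_neg hχ]
      have hL' : invLFactor χ⁻¹ (1 - s) = 1 := by rw [invLFactor, if_neg hχ']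
      refine epsilonStrip_eq μ hψ hψ1 hs0 hs1 (g := g)
        (isLocallyConstant_indicator (isClopen_normAbs_sub_le 1 (normAbs_pos hc0)))
        (hasCompactSupport_indicator_normAbs_sub_le 1 _) ?_ ?_
      · rw [hzg, hL, mul_one]
        exact_mod_cast hm0.ne'
      · rw [hzg, hL, hL', hZ]
        ring
    · have h1 : Tendsto (fun s : ℝ => normAbs b ^ (-s)) (𝓝 0) (𝓝 1) := by
        have hc : Continuous fun s : ℝ => normAbs b ^ (-s) :=
          Continuous.rpow (by fun_prop) (by fun_prop) fun _ => Or.inl (normAbs_ne_zero hb0)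
        simpa using hc.tendsto 0
      have h2 := ((Complex.continuous_ofReal.tendsto _).comp h1).mul_const T
      simpa using h2
  rw [heps, hT, integral_eq_mul_integral_comp μ hb0, mul_assoc, ← integral_const_mul (charExt χ⁻¹ b)]
  congr 2; ext z
  rw [charExt_mul]
  simp only [Set.indicator_apply, Set.mem_ofPred_eq, normAbs_mul, mul_eq_left₀ (normAbs_ne_zero hb0),
    Pi.one_apply]
  ring

end RootNumbers

end LocalRoot

namespace LocalRoot

/-! ### Square roots and values of a binary quadratic form, by Hensel's lemma. -/

section Hensel

variable {F : Type*} [Field F] [ValuativeRel F] [TopologicalSpace F] [IsNonarchimedeanLocalField F]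

lemma normAbs_two (hp : ringChar 𝓀[F] ≠ 2) : normAbs (2 : F) = 1 := by
  apply le_antisymm
  · have := normAbs_add_le_of_le (normAbs_one (K := F)).le normAbs_one.le
    rwa [one_add_one_eq_two] at this
  · by_contra! h
    have h1 : (2 : 𝒪[F]) ∈ 𝓂[F] := mem_maximalIdeal_iff.2 (by exact_mod_cast h)
    have h2 : (2 : IsLocalRing.ResidueField 𝒪[F]) = 0 := by
      rw [← map_ofNat (IsLocalRing.residue 𝒪[F]) 2]
      exact (IsLocalRing.residue_eq_zero_iff (2 : 𝒪[F])).2 h1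
    exact Ring.two_ne_zero hp h2

/-- Hensel's lemma for `X² - u` at the approximate root `t`: the derivative `2t` is a unit. -/
lemma exists_sq_eq (h2 : normAbs (2 : F) = 1) {u t : F} (hu : normAbs u = 1)
    (ht : normAbs (t ^ 2 - u) < 1) : ∃ x, x ^ 2 = u ∧ normAbs x = 1 := by
  let := IsTopologicalAddGroup.rightUniformSpace F
  have := isUniformAddGroup_of_addCommGroup (G := F)
  have ht2 : normAbs (t ^ 2) = 1 := by
    have := normAbs_add_eq_of_lt (x := u) (y := t ^ 2 - u) (by rwa [hu])
    rwa [add_sub_cancel, hu] at this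
  have ht1 : normAbs t = 1 := by
    rw [normAbs_pow] at ht2
    exact (pow_eq_one_iff_of_nonneg (normAbs_nonneg t) two_ne_zero).1 ht2
  let u' : 𝒪[F] := ⟨u, normAbs_le_one.1 hu.le⟩
  let t' : 𝒪[F] := ⟨t, normAbs_le_one.1 ht1.le⟩
  obtain ⟨x, hx, -⟩ := HenselianRing.is_henselian (I := 𝓂[F]) (Polynomial.X ^ 2 - Polynomial.C u')
    (Polynomial.monic_X_pow_sub_C u' two_ne_zero) t' (by
      rw [mem_maximalIdeal_iff]; simpa [u', t'] using ht) (by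
      refine IsUnit.map _ ?_
      by_contra hn
      have h3 : ((Polynomial.X ^ 2 - Polynomial.C u').derivative.eval t') ∈ 𝓂[F] := hn
      rw [mem_maximalIdeal_iff] at h3
      have : normAbs ((2 : F) * t) = 1 := by rw [normAbs_mul, h2, ht1, one_mul]
      simp only [Polynomial.derivative_sub, Polynomial.derivative_X_pow, Polynomial.derivative_C,
        Nat.cast_ofNat, Nat.add_one_sub_one, pow_one, sub_zero, Polynomial.eval_mul,
        Polynomial.eval_X, map_ofNat, Polynomial.eval_ofNat] at h3
      exact h3.ne this)
  have hx2 : (x : F) ^ 2 = u := by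
    have : x ^ 2 - u' = 0 := by simpa [Polynomial.IsRoot] using hx
    exact congrArg Subtype.val (sub_eq_zero.1 this)
  refine ⟨x, hx2, ?_⟩
  rw [← hx2, normAbs_pow] at hu
  exact (pow_eq_one_iff_of_nonneg (normAbs_nonneg _) two_ne_zero).1 hu

lemma exists_residue_sq_add (h2 : ringChar 𝓀[F] ≠ 2) {D u : F} (hD : normAbs D = 1) (hu : normAbs u = 1) :
    ∃ a b : F, normAbs a ≤ 1 ∧ normAbs b ≤ 1 ∧ normAbs (a ^ 2 + D * b ^ 2 - u) < 1 := by
  let u' : 𝒪[F] := ⟨u, normAbs_le_one.1 hu.le⟩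
  let D' : 𝒪[F] := ⟨D, normAbs_le_one.1 hD.le⟩
  let k := IsLocalRing.ResidueField 𝒪[F]
  have : Finite k := inferInstanceAs (Finite 𝓀[F])
  have : Fintype k := Fintype.ofFinite _
  let r := IsLocalRing.residue 𝒪[F]
  have hD0 : r D' ≠ 0 := by
    intro h
    have := mem_maximalIdeal_iff.1 ((IsLocalRing.residue_eq_zero_iff D').1 h)
    exact this.ne hD
  obtain ⟨a, b, hab⟩ := FiniteField.exists_root_sum_quadratic
    (f := (Polynomial.X ^ 2 - Polynomial.C (r u') : Polynomial k))
    (g := (Polynomial.C (r D') * Polynomial.X ^ 2 : Polynomial k))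
    (Polynomial.degree_X_pow_sub_C two_pos _) (Polynomial.degree_C_mul_X_pow 2 hD0)
    (FiniteField.odd_card_of_char_ne_two h2)
  obtain ⟨a, rfl⟩ := IsLocalRing.residue_surjective a
  obtain ⟨b, rfl⟩ := IsLocalRing.residue_surjective b
  refine ⟨a, b, normAbs_le_one.2 a.2, normAbs_le_one.2 b.2, ?_⟩
  have h3 : r (a ^ 2 + D' * b ^ 2 - u') = 0 := by
    simp only [Polynomial.eval_sub, Polynomial.eval_pow, Polynomial.eval_X, Polynomial.eval_C,
      Polynomial.eval_mul] at hab
    simp only [map_sub, map_add, map_mul, map_pow]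
    linear_combination hab
  exact mem_maximalIdeal_iff.1 ((IsLocalRing.residue_eq_zero_iff _).1 h3)

/-- Over a finite field of odd order a counting argument solves the congruence. To lift, keep one
variable fixed and extract a square root for the other: `a` is refined if it is a unit, and
otherwise `D b²` is congruent to a unit and `b` is refined. -/
lemma exists_sq_add_mul_sq_eq (h2 : ringChar 𝓀[F] ≠ 2) {D u : F} (hD : normAbs D = 1) (hu : normAbs u = 1) :
    ∃ a b : F, a ^ 2 + D * b ^ 2 = u := by
  obtain ⟨a, b, ha, hb, hab⟩ := exists_residue_sq_add h2 hD hu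
  have hD0 : D ≠ 0 := by rintro rfl; simp at hD
  have ht := normAbs_two h2
  rcases ha.lt_or_eq with ha | ha
  · have h1 : normAbs (a ^ 2) < normAbs u := by
      rw [hu, normAbs_pow]; exact pow_lt_one₀ (normAbs_nonneg _) ha two_ne_zero
    have h3 : normAbs (u - a ^ 2) = 1 := by
      rw [sub_eq_add_neg, normAbs_add_eq_of_lt (by simpa using h1), hu]
    obtain ⟨x, hx, -⟩ := exists_sq_eq ht (u := (u - a ^ 2) / D) (t := b) (by rw [normAbs_div, h3, hD, div_one])
      (by
        have : b ^ 2 - (u - a ^ 2) / D = (a ^ 2 + D * b ^ 2 - u) / D := by field_simp; ring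
        rw [this, normAbs_div, hD, div_one]; exact hab)
    exact ⟨a, x, by rw [hx]; field_simp; ring⟩
  · have h3 : normAbs (u - D * b ^ 2) = 1 := by
      have h4 : u - D * b ^ 2 = a ^ 2 + -(a ^ 2 + D * b ^ 2 - u) := by ring
      rw [h4, normAbs_add_eq_of_lt] <;> rw [normAbs_pow, ha, one_pow]
      rwa [normAbs_neg]
    obtain ⟨x, hx, -⟩ := exists_sq_eq ht (u := u - D * b ^ 2) (t := a) h3
      (by rwa [show a ^ 2 - (u - D * b ^ 2) = a ^ 2 + D * b ^ 2 - u by ring])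
    exact ⟨x, b, by rw [hx]; ring⟩

end Hensel

/-! ### Arithmetic of the unramified quadratic extension. -/

section Quadratic

variable {F K : Type*} [Field F] [ValuativeRel F] [TopologicalSpace F] [IsNonarchimedeanLocalField F]
    [Field K] [ValuativeRel K] [TopologicalSpace K] [IsNonarchimedeanLocalField K] [Algebra F K]

/-- `K = F(δ)` is an unramified quadratic extension of odd residue characteristic, where `δ` is a
unit with `δ² = -D`. -/
structure IsUnramifiedQuadratic (F : Type*) {K : Type*} [Field F] [ValuativeRel F]
    [TopologicalSpace F] [IsNonarchimedeanLocalField F] [Field K] [ValuativeRel K]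
    [TopologicalSpace K] [IsNonarchimedeanLocalField K] [Algebra F K] (D : F) (δ : K) : Prop where
  ringChar_ne : ringChar 𝓀[F] ≠ 2
  finrank_eq : Module.finrank F K = 2
  isUnramified : IsUnramifiedExtension F K
  sq_eq : δ ^ 2 = algebraMap F K (-D)
  adjoin_eq : IntermediateField.adjoin F {δ} = ⊤
  normAbs_eq : normAbs δ = 1

section

variable [ValuativeExtension F K]

/-- The normalized absolute values of `F` and `K` need not agree on `F`, so only comparisons are
transferred between the two fields. -/
lemma normAbs_algebraMap_le_iff {x y : F} :
    normAbs (algebraMap F K x) ≤ normAbs (algebraMap F K y) ↔ normAbs x ≤ normAbs y := by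
  rw [normAbs_le_normAbs, normAbs_le_normAbs, ← Valuation.Compatible.vle_iff_le,
    ← Valuation.Compatible.vle_iff_le, ValuativeExtension.vle_iff_vle]

lemma normAbs_algebraMap_lt_iff {x y : F} :
    normAbs (algebraMap F K x) < normAbs (algebraMap F K y) ↔ normAbs x < normAbs y := by
  simpa using (normAbs_algebraMap_le_iff (K := K) (x := y) (y := x)).not

lemma normAbs_algebraMap_eq_iff {x y : F} :
    normAbs (algebraMap F K x) = normAbs (algebraMap F K y) ↔ normAbs x = normAbs y := by
  rw [le_antisymm_iff, le_antisymm_iff, normAbs_algebraMap_le_iff, normAbs_algebraMap_le_iff]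

lemma normAbs_algebraMap_eq_one_iff {x : F} : normAbs (algebraMap F K x) = 1 ↔ normAbs x = 1 := by
  simpa using normAbs_algebraMap_eq_iff (K := K) (x := x) (y := 1)

end

namespace IsUnramifiedQuadratic

variable {D : F} {δ : K} (H : IsUnramifiedQuadratic F D δ)
include H

lemma normAbs_two : normAbs (2 : F) = 1 := LocalRoot.normAbs_two H.ringChar_ne

lemma two_ne_zero' : (2 : F) ≠ 0 := fun h => by
  have := H.normAbs_two
  rw [h] at this; simp at this

lemma gen_ne_zero : δ ≠ 0 := by rintro rfl; simpa using H.normAbs_eq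

lemma notMem_range (t : F) : algebraMap F K t ≠ δ := by
  intro h
  have h1 : IntermediateField.adjoin F {δ} = ⊥ := by
    rw [IntermediateField.adjoin_simple_eq_bot_iff]
    exact ⟨t, h⟩
  have h2 := H.adjoin_eq
  rw [h1] at h2
  have h3 : Module.finrank F K = 1 := by
    rw [← IntermediateField.finrank_top', ← h2, IntermediateField.finrank_bot]
  have := H.finrank_eq
  omega

lemma linearIndependent : LinearIndependent F ![(1 : K), δ] := by
  rw [LinearIndependent.pair_iff]
  intro s t hst
  rw [Algebra.smul_def, Algebra.smul_def, mul_one] at hst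
  have ht : t = 0 := by
    by_contra ht
    refine H.notMem_range (-s / t) ?_
    have : algebraMap F K t ≠ 0 := by simpa
    rw [map_div₀, map_neg]
    field_simp
    linear_combination -hst
  subst ht
  simpa using hst

/-- The basis `1, δ`. -/
def basis : Module.Basis (Fin 2) F K :=
  basisOfLinearIndependentOfCardEqFinrank H.linearIndependent (by simp [H.finrank_eq])

lemma basis_zero : H.basis 0 = 1 := by simp [basis]

lemma basis_one : H.basis 1 = δ := by simp [basis]

lemma exists_eq (z : K) : ∃ a b : F, z = algebraMap F K a + algebraMap F K b * δ := by
  refine ⟨H.basis.repr z 0, H.basis.repr z 1, ?_⟩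
  conv_lhs => rw [← H.basis.sum_repr z]
  simp [Fin.sum_univ_two, basis_zero, basis_one, Algebra.smul_def]

lemma repr_eq (a b : F) (i : Fin 2) :
    H.basis.repr (algebraMap F K a + algebraMap F K b * δ) i = ![a, b] i := by
  have : algebraMap F K a + algebraMap F K b * δ = a • H.basis 0 + b • H.basis 1 := by
    rw [H.basis_zero, H.basis_one, Algebra.smul_def, Algebra.smul_def, mul_one]
  rw [this, map_add, map_smul, map_smul, H.basis.repr_self, H.basis.repr_self]
  fin_cases i <;> simp

lemma leftMulMatrix_eq (a b : F) :
    Algebra.leftMulMatrix H.basis (algebraMap F K a + algebraMap F K b * δ) = !![a, -(D * b); b, a] := by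
  ext i j
  rw [Algebra.leftMulMatrix_eq_repr_mul]
  fin_cases j
  · simp only [Fin.zero_eta, H.basis_zero, mul_one, H.repr_eq]
    fin_cases i <;> simp
  · have : (algebraMap F K a + algebraMap F K b * δ) * δ =
        algebraMap F K (-(D * b)) + algebraMap F K a * δ := by
      have := H.sq_eq
      rw [map_neg] at this ⊢
      rw [map_mul]
      linear_combination algebraMap F K b * this
    simp only [Fin.mk_one, H.basis_one, this, H.repr_eq]
    fin_cases i <;> simp

lemma trace_eq (a b : F) :
    Algebra.trace F K (algebraMap F K a + algebraMap F K b * δ) = 2 * a := by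
  rw [Algebra.trace_eq_matrix_trace H.basis, H.leftMulMatrix_eq, Matrix.trace_fin_two]
  simp; ring

lemma norm_eq (a b : F) :
    Algebra.norm F (algebraMap F K a + algebraMap F K b * δ) = a ^ 2 + D * b ^ 2 := by
  rw [Algebra.norm_eq_matrix_det H.basis, H.leftMulMatrix_eq, Matrix.det_fin_two]
  simp; ring

variable [ValuativeExtension F K]

lemma normAbs_D : normAbs D = 1 := by
  have h := congrArg normAbs H.sq_eq
  rw [normAbs_pow, H.normAbs_eq, one_pow, map_neg, normAbs_neg, eq_comm] at h
  exact normAbs_algebraMap_eq_one_iff.1 h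

/-- If `t + δ` were not a unit, then neither would be `(t + δ)(t - δ) = t² + D`. Hensel's lemma
would then produce a square root of `-D` in `F`, forcing `δ` into `F`. -/
lemma normAbs_add_gen {t : F} (ht : normAbs t = 1) : normAbs (algebraMap F K t + δ) = 1 := by
  have ht' := normAbs_algebraMap_eq_one_iff (K := K).2 ht
  refine le_antisymm (normAbs_add_le_of_le ht'.le H.normAbs_eq.le) ?_
  by_contra! hlt
  have h1 : algebraMap F K (t ^ 2 - -D) = (algebraMap F K t + δ) * (algebraMap F K t - δ) := by
    rw [map_sub, ← H.sq_eq, map_pow]; ring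
  have h2 : normAbs (t ^ 2 - -D) < 1 := by
    rw [← normAbs_one (K := F), ← normAbs_algebraMap_lt_iff (K := K), h1, normAbs_mul, map_one, normAbs_one]
    calc _ ≤ normAbs (algebraMap F K t + δ) * 1 :=
          mul_le_mul_of_nonneg_left (normAbs_sub_le_of_le ht'.le H.normAbs_eq.le) (normAbs_nonneg _)
      _ < 1 := by rwa [mul_one]
  obtain ⟨x, hx, -⟩ := exists_sq_eq H.normAbs_two (by rw [normAbs_neg, H.normAbs_D]) h2
  have h3 : algebraMap F K x ^ 2 = δ ^ 2 := by rw [← map_pow, hx, H.sq_eq]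
  rcases sq_eq_sq_iff_eq_or_eq_neg.1 h3 with h4 | h4
  · exact H.notMem_range x h4
  · exact H.notMem_range (-x) (by rw [map_neg, h4, neg_neg])

/-- Equivalently, `𝒪_K = 𝒪_F ⊕ 𝒪_F δ`. Cancellation is possible only when the two terms have equal
size, and `normAbs_add_gen` excludes it there. -/
lemma normAbs_add_mul (a b : F) : normAbs (algebraMap F K a + algebraMap F K b * δ) =
    max (normAbs (algebraMap F K a)) (normAbs (algebraMap F K b)) := by
  have hb : normAbs (algebraMap F K b * δ) = normAbs (algebraMap F K b) := by
    rw [normAbs_mul, H.normAbs_eq, mul_one]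
  rcases lt_trichotomy (normAbs (algebraMap F K a)) (normAbs (algebraMap F K b)) with h | h | h
  · rw [add_comm, normAbs_add_eq_of_lt (by rwa [hb]), hb, max_eq_right h.le]
  · by_cases hb0 : b = 0
    · simp only [hb0, map_zero, normAbs_zero, zero_mul, add_zero] at h ⊢
      rw [h, max_self]
    · have hb1 : algebraMap F K b ≠ 0 := by simpa
      have h1 : algebraMap F K a + algebraMap F K b * δ =
          algebraMap F K b * (algebraMap F K (a / b) + δ) := by
        rw [map_div₀]; field_simp
      rw [h1, normAbs_mul, H.normAbs_add_gen, mul_one, h, max_self]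
      rw [normAbs_div, div_eq_one_iff_eq (normAbs_ne_zero hb0)]
      exact normAbs_algebraMap_eq_iff.1 h
  · rw [normAbs_add_eq_of_lt (by rwa [hb]), max_eq_left h.le]

variable {κ : Fˣ →ₜ* Circle} (hκ : IsQuadraticCharacter F K κ)
include hκ

/-- Every unit of `F` has the form `a² + D b²`, which is the norm of `a + b δ`. -/
lemma isUnramifiedChar : IsUnramifiedChar κ := by
  intro u hu
  obtain ⟨a, b, hab⟩ := exists_sq_add_mul_sq_eq H.ringChar_ne H.normAbs_D (mem_unitGroup_iff.1 hu)
  refine Circle.ext ?_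
  have hne : algebraMap F K a + algebraMap F K b * δ ≠ 0 := by
    intro h0
    have := H.norm_eq a b
    have hfin : Module.Finite F K := Module.finite_of_finrank_eq_succ H.finrank_eq
    rw [h0, hab, Algebra.norm_zero] at this
    exact u.ne_zero this.symm
  rw [hκ u, if_pos ⟨Units.mk0 _ hne, by rw [Units.val_mk0, H.norm_eq, hab]⟩, Circle.coe_one]

/-- A norm is `y` times its conjugate, and both have the same absolute value, so its valuation in
`K` is even. But `ϖ` remains a uniformizer of `K`. -/
lemma charExt_uniformizer {ϖ : F} (h : IsUniformizer ϖ) : charExt κ ϖ = -1 := by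
  rw [charExt_of_ne_zero κ h.ne_zero, hκ, if_neg]
  rintro ⟨y, hy⟩
  obtain ⟨a, b, hab⟩ := H.exists_eq (y : K)
  have h1 : algebraMap F K ϖ = y * (algebraMap F K a + algebraMap F K (-b) * δ) := by
    rw [Units.val_mk0, hab, H.norm_eq] at hy
    rw [← hy, hab, map_neg]
    have := H.sq_eq
    rw [map_neg] at this
    simp only [map_add, map_mul, map_pow]
    linear_combination algebraMap F K b ^ 2 * this
  have h2 : normAbs (algebraMap F K ϖ) = normAbs (y : K) ^ 2 := by
    rw [h1, normAbs_mul, H.normAbs_add_mul, hab, H.normAbs_add_mul, map_neg, normAbs_neg, sq]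
  have hK := H.isUnramified ϖ h
  obtain ⟨n, hn⟩ := exists_normAbs_eq_zpow hK y.ne_zero
  rw [hn, ← zpow_natCast, ← zpow_mul] at h2
  have h3 : (1 : ℤ) = n * (2 : ℕ) :=
    zpow_right_injective₀ hK.normAbs_pos hK.normAbs_lt_one.ne (by simpa using h2)
  omega

end IsUnramifiedQuadratic

end Quadratic

end LocalRoot

namespace LocalRoot

/-! ### The decomposition `K = F ⊕ F δ`: topology, trace and measure. -/

section QuadraticMeasure

variable {F K : Type*} [Field F] [ValuativeRel F] [TopologicalSpace F] [IsNonarchimedeanLocalField F]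
    [Field K] [ValuativeRel K] [TopologicalSpace K] [IsNonarchimedeanLocalField K] [Algebra F K]
    [ValuativeExtension F K]

namespace IsUnramifiedQuadratic

variable {D : F} {δ : K} (H : IsUnramifiedQuadratic F D δ)
include H

lemma continuous_algebraMap : Continuous (algebraMap F K) := by
  refine continuous_of_continuousAt_zero (algebraMap F K) ?_
  rw [ContinuousAt, map_zero, (nhds_zero_hasBasis F).tendsto_iff (nhds_zero_hasBasis K)]
  intro ε hε
  obtain ⟨ϖ, h⟩ := exists_isUniformizer F
  have hK := H.isUnramified ϖ h
  obtain ⟨n, hn⟩ := exists_pow_lt_of_lt_one hε hK.normAbs_lt_one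
  refine ⟨normAbs (ϖ ^ n), normAbs_pos (pow_ne_zero _ h.ne_zero), fun x hx => ?_⟩
  have := normAbs_algebraMap_lt_iff (K := K).2 hx
  rw [map_pow, normAbs_pow] at this
  exact this.trans hn

lemma continuous_of_normAbs_algebraMap_le {g : K →+ F} (hg : ∀ z, normAbs (algebraMap F K (g z)) ≤ normAbs z) :
    Continuous g := by
  refine continuous_of_continuousAt_zero g ?_
  rw [ContinuousAt, map_zero, (nhds_zero_hasBasis K).tendsto_iff (nhds_zero_hasBasis F)]
  intro ε hε
  obtain ⟨ϖ, h⟩ := exists_isUniformizer F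
  obtain ⟨n, hn⟩ := exists_pow_lt_of_lt_one hε h.normAbs_lt_one
  refine ⟨normAbs (algebraMap F K (ϖ ^ n)), normAbs_pos (by simp [h.ne_zero]), fun x hx => ?_⟩
  have := normAbs_algebraMap_lt_iff (K := K).1 ((hg x).trans_lt hx)
  rw [normAbs_pow] at this
  exact this.trans hn

/-- The decomposition `K = F ⊕ F δ`. -/
def coords : F × F ≃+ K where
  toFun p := algebraMap F K p.1 + algebraMap F K p.2 * δ
  invFun z := (H.basis.repr z 0, H.basis.repr z 1)
  left_inv p := Prod.ext (H.repr_eq p.1 p.2 0) (H.repr_eq p.1 p.2 1)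
  right_inv z := by
    obtain ⟨a, b, rfl⟩ := H.exists_eq z
    simp only [H.repr_eq]
    rfl
  map_add' p q := by simp only [Prod.fst_add, Prod.snd_add, map_add]; ring

lemma coords_apply (p : F × F) : H.coords p = algebraMap F K p.1 + algebraMap F K p.2 * δ := rfl

lemma coords_symm_apply (a b : F) : H.coords.symm (algebraMap F K a + algebraMap F K b * δ) = (a, b) :=
  H.coords.symm_apply_apply (a, b)

lemma continuous_coords : Continuous H.coords := by
  have := H.continuous_algebraMap
  simp only [funext H.coords_apply]
  fun_prop

lemma continuous_coords_symm : Continuous H.coords.symm := by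
  have h1 : Continuous ((AddMonoidHom.fst F F).comp H.coords.symm.toAddMonoidHom) :=
    H.continuous_of_normAbs_algebraMap_le fun z => by
      obtain ⟨a, b, rfl⟩ := H.exists_eq z
      simp only [AddMonoidHom.coe_comp, Function.comp, AddEquiv.coe_toAddMonoidHom,
        H.coords_symm_apply, AddMonoidHom.coe_fst, H.normAbs_add_mul]
      exact le_max_left _ _
  have h2 : Continuous ((AddMonoidHom.snd F F).comp H.coords.symm.toAddMonoidHom) :=
    H.continuous_of_normAbs_algebraMap_le fun z => by
      obtain ⟨a, b, rfl⟩ := H.exists_eq z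
      simp only [AddMonoidHom.coe_comp, Function.comp, AddEquiv.coe_toAddMonoidHom,
        H.coords_symm_apply, AddMonoidHom.coe_snd, H.normAbs_add_mul]
      exact le_max_right _ _
  exact h1.prodMk h2

lemma continuous_trace : Continuous (Algebra.trace F K) := by
  have : ∀ z, Algebra.trace F K z = 2 * (H.coords.symm z).1 := by
    intro z
    obtain ⟨a, b, rfl⟩ := H.exists_eq z
    rw [H.trace_eq, H.coords_symm_apply]
  have h1 := H.continuous_coords_symm
  exact (continuous_const.mul (continuous_fst.comp h1)).congr fun z => (this z).symm

lemma normAbs_trace_le (z : K) {c : F} (hz : normAbs z ≤ normAbs (algebraMap F K c)) :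
    normAbs (Algebra.trace F K z) ≤ normAbs c := by
  obtain ⟨a, b, rfl⟩ := H.exists_eq z
  rw [H.normAbs_add_mul] at hz
  rw [H.trace_eq, normAbs_mul, H.normAbs_two, one_mul]
  exact normAbs_algebraMap_le_iff.1 ((le_max_left _ _).trans hz)

lemma trace_half (x : F) : Algebra.trace F K (algebraMap F K (x / 2)) = x := by
  have := H.trace_eq (x / 2) 0
  rw [map_zero, zero_mul, add_zero] at this
  rw [this, mul_div_cancel₀ _ H.two_ne_zero']

lemma continuous_traceChar {ψ : AddChar F Circle} (hψ : Continuous ψ) : Continuous (traceChar K ψ) :=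
  hψ.comp H.continuous_trace

lemma traceChar_ne_one {ψ : AddChar F Circle} (hψ1 : ψ ≠ 1) : traceChar K ψ ≠ 1 := by
  intro h
  refine hψ1 (DFunLike.ext _ _ fun x => ?_)
  rw [← H.trace_half x]
  exact DFunLike.congr_fun h (algebraMap F K (x / 2))

/-- The trace sends `a 𝒪_K` into `a 𝒪_F`. Conversely, if `|y|` exceeds `|a|`, so does a coordinate
`c` of `y`; since `2` is a unit, any `x` in `c 𝒪_F` is the trace of `x / 2`, of the same size. -/
lemma isConductorGenerator_traceChar {ψ : AddChar F Circle} {a : F} (ha : IsConductorGenerator ψ a) :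
    IsConductorGenerator (traceChar K ψ) (algebraMap F K a) := by
  refine ⟨by simpa using ha.1, fun x hx => ha.2.1 _ (H.normAbs_trace_le x hx), fun y hy => ?_⟩
  obtain ⟨p, q, rfl⟩ := H.exists_eq y
  obtain ⟨c, hc, hle⟩ : ∃ c : F, normAbs (algebraMap F K a) < normAbs (algebraMap F K c) ∧
      normAbs (algebraMap F K c) ≤ normAbs (algebraMap F K p + algebraMap F K q * δ) := by
    rw [H.normAbs_add_mul] at hy ⊢
    rcases lt_max_iff.1 hy with h | h
    · exact ⟨p, h, le_max_left _ _⟩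
    · exact ⟨q, h, le_max_right _ _⟩
  obtain ⟨x, hx, hx1⟩ := ha.2.2 c (normAbs_algebraMap_lt_iff.1 hc)
  refine ⟨algebraMap F K (x / 2), le_trans ?_ hle, ?_⟩
  · rw [normAbs_algebraMap_le_iff, normAbs_div, H.normAbs_two, div_one]
    exact hx
  · change ψ (Algebra.trace F K _) ≠ 1
    rwa [H.trace_half]

variable [MeasurableSpace F] [BorelSpace F] [MeasurableSpace K] [BorelSpace K]
  (μF : Measure F) [μF.IsAddHaarMeasure] (μK : Measure K) [μK.IsAddHaarMeasure]

/-- A Haar measure on `K` is a multiple of the product of Haar measures on `F`. -/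
lemma exists_measureReal_eq : ∃ C : ℝ, ∀ A B : Set F, MeasurableSet A → MeasurableSet B →
    μK.real {z | ∃ a ∈ A, ∃ b ∈ B, z = algebraMap F K a + algebraMap F K b * δ} =
      C * (μF.real A * μF.real B) := by
  have hh : (Measure.map H.coords (μF.prod μF)).IsAddHaarMeasure :=
    H.coords.isAddHaarMeasure_map (μF.prod μF) H.continuous_coords H.continuous_coords_symm
  obtain ⟨C, h1⟩ : ∃ C : NNReal, μK = C • Measure.map H.coords (μF.prod μF) :=
    ⟨_, Measure.isAddLeftInvariant_eq_smul μK (Measure.map H.coords (μF.prod μF))⟩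
  refine ⟨C, fun A B hA hB => ?_⟩
  have hset : {z | ∃ a ∈ A, ∃ b ∈ B, z = algebraMap F K a + algebraMap F K b * δ} =
      H.coords.symm ⁻¹' (A ×ˢ B) := by
    ext z
    constructor
    · rintro ⟨a, ha, b, hb, rfl⟩
      rw [← H.coords_apply (a, b), Set.mem_preimage, AddEquiv.symm_apply_apply]
      exact ⟨ha, hb⟩
    · rintro ⟨ha, hb⟩
      exact ⟨_, ha, _, hb, (H.coords.apply_symm_apply z).symm⟩
  have hm : MeasurableSet (H.coords.symm ⁻¹' (A ×ˢ B)) :=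
    H.continuous_coords_symm.measurable (hA.prod hB)
  rw [hset, Measure.real, h1, Measure.smul_apply,
    Measure.map_apply H.continuous_coords.measurable hm, ← Set.preimage_comp]
  have : (H.coords.symm : K → F × F) ∘ H.coords = id := funext fun p => H.coords.symm_apply_apply p
  rw [this, Set.preimage_id, Measure.prod_prod]
  simp [Measure.real, ENNReal.smul_def]

end IsUnramifiedQuadratic

end QuadraticMeasure

end LocalRoot

namespace LocalRoot

/-! ### The Gauss integral of `χ` and its root number. -/

section QuadraticRootNumber

variable {F K : Type*} [Field F] [ValuativeRel F] [TopologicalSpace F] [IsNonarchimedeanLocalField F]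
    [Field K] [ValuativeRel K] [TopologicalSpace K] [IsNonarchimedeanLocalField K] [Algebra F K]
    [ValuativeExtension F K]
    [MeasurableSpace F] [BorelSpace F] [MeasurableSpace K] [BorelSpace K]

lemma measurableSet_trace_le {D : F} {δ : K} (H : IsUnramifiedQuadratic F D δ) (r : ℝ) :
    MeasurableSet {z : K | normAbs (Algebra.trace F K z) ≤ r} :=
  H.continuous_trace.measurable (measurableSet_normAbs_le r)

/-- Subtract the transforms of the balls `𝒪` and `ϖ 𝒪`. This evaluates the average of `ψ(xy)` over
units `x`. -/
lemma fourier_indicator_sphere {μF : Measure F} [μF.IsAddHaarMeasure] {ψ : AddChar F Circle} {a : F}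
    (hψ : Continuous ψ) (ha : IsConductorGenerator ψ a) {ϖ : F} (h : IsUniformizer ϖ) (y : F) :
    fourier ψ μF ({x : F | normAbs x = 1}.indicator 1) y = (μF.real {x : F | normAbs x ≤ 1} : ℂ) *
      ({y : F | normAbs y ≤ normAbs a}.indicator 1 y -
        (normAbs ϖ : ℂ) * {y : F | normAbs y ≤ normAbs (a / ϖ)}.indicator 1 y) := by
  have hball : ∀ c : F, c ≠ 0 → fourier ψ μF ({x : F | normAbs x ≤ normAbs c}.indicator 1) y =
      (μF.real {x : F | normAbs x ≤ normAbs c} : ℂ) *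
        {y : F | normAbs y ≤ normAbs (a / c)}.indicator 1 y := by
    intro c hc
    simpa using fourier_indicator_ball (μ := μF) ha 0 hc y
  have hint : ∀ S : Set F, IsTame (S.indicator 1) →
      Integrable (fun x => S.indicator (1 : F → ℂ) x * (ψ (x * y) : ℂ)) μF := by
    intro S hS
    have hc : Continuous fun x : F => (ψ (x * y) : ℂ) :=
      continuous_circle_coe.comp (hψ.comp (by fun_prop))
    exact (hS.integrable μF).mul_bdd (c := 1) hc.aestronglyMeasurable
      (Eventually.of_forall fun p => (Circle.norm_coe _).le)
  have h1 : fourier ψ μF ({x : F | normAbs x ≤ normAbs (1 : F)}.indicator 1) y =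
      fourier ψ μF ({x : F | normAbs x = 1}.indicator 1) y +
        fourier ψ μF ({x : F | normAbs x ≤ normAbs ϖ}.indicator 1) y := by
    simp only [fourier]
    rw [← integral_add (hint _ (isTame_indicator_eq 1)) (hint _ (isTame_indicator_le _))]
    congr 1; ext x
    rw [indicator_ball_eq_sphere_add h one_ne_zero x, mul_one, normAbs_one, add_mul]
  rw [hball 1 one_ne_zero, hball ϖ h.ne_zero, measureReal_ball_uniformizer h, div_one, normAbs_one] at h1
  push_cast at h1
  linear_combination -h1

lemma charExt_pow (χ : Fˣ →ₜ* Circle) (x : F) (n : ℕ) :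
    charExt χ (x ^ n) = charExt χ x ^ n := by
  induction n with
  | zero => simpa using charExt_units χ 1
  | succ n ih => rw [pow_succ, charExt_mul, ih, pow_succ]

lemma charExt_algebraMap {χ : Kˣ →ₜ* Circle} {κ : Fˣ →ₜ* Circle}
    (hχκ : ∀ x : Fˣ, χ (Units.map (algebraMap F K : F →* K) x) = κ x) (x : F) :
    charExt χ (algebraMap F K x) = charExt κ x := by
  by_cases hx : x = 0
  · simp [hx]
  · have := charExt_units χ (Units.map (algebraMap F K : F →* K) (Units.mk0 x hx))
    rw [hχκ] at this
    rw [charExt_of_ne_zero κ hx, ← this]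
    rfl

namespace IsUnramifiedQuadratic

variable {D : F} {δ : K} (H : IsUnramifiedQuadratic F D δ)
include H

lemma trace_algebraMap_mul (x : F) (z : K) :
    Algebra.trace F K (algebraMap F K x * z) = x * Algebra.trace F K z := by
  rw [← Algebra.smul_def, map_smul, smul_eq_mul]

lemma trace_gen : Algebra.trace F K δ = 0 := by
  simpa using H.trace_eq 0 1

variable {κ : Fˣ →ₜ* Circle} (hκ : IsQuadraticCharacter F K κ) {χ : Kˣ →ₜ* Circle}
    (hχκ : ∀ x : Fˣ, χ (Units.map (algebraMap F K : F →* K) x) = κ x)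
    {μK : Measure K} [μK.IsAddHaarMeasure]
include hκ hχκ

lemma charExt_algebraMap_eq_one {x : F} (hx : normAbs x = 1) : charExt χ (algebraMap F K x) = 1 := by
  rw [charExt_algebraMap hχκ, (H.isUnramifiedChar hκ).charExt_eq_one hx]

omit hκ hχκ in
-- Choose `u` in `1 + 𝔪^n` with `χ u ≠ 1`. For a unit `z`, replacing `z` by `uz` moves the trace by
-- an element of `ϖ^n 𝒪_F`, so the domain is preserved while the integral is multiplied by `χ⁻¹(u)`.
lemma integral_trace_lt {ϖ : F} (h : IsUniformizer ϖ) {n : ℕ} (hn : n < conductorExponent χ) :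
    ∫ z, {z : K | normAbs z = 1}.indicator 1 z * charExt χ⁻¹ z *
      {z : K | normAbs (Algebra.trace F K z) ≤ normAbs (ϖ ^ n)}.indicator 1 z ∂μK = 0 := by
  obtain ⟨u, hu, hu1⟩ := exists_ne_one_of_lt_conductorExponent hn
  rw [mem_higherUnits_iff (H.isUnramified ϖ h), ← normAbs_pow, ← map_pow] at hu
  set G : K → ℂ := fun z => {z : K | normAbs z = 1}.indicator 1 z * charExt χ⁻¹ z *
      {z : K | normAbs (Algebra.trace F K z) ≤ normAbs (ϖ ^ n)}.indicator 1 z with hG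
  have h1 : ∀ z, G ((u : K) * z) = (χ⁻¹ u : ℂ) * G z := by
    intro z
    simp only [hG, charExt_mul, charExt_units, Set.indicator_apply, Set.mem_ofPred_eq, normAbs_mul, hu.1,
      one_mul, Pi.one_apply]
    by_cases hz : normAbs z = 1
    · have h2 : normAbs (Algebra.trace F K (((u : K) - 1) * z)) ≤ normAbs (ϖ ^ n) :=
        H.normAbs_trace_le _ (by rw [normAbs_mul, hz, mul_one]; exact hu.2)
      have h3 : Algebra.trace F K ((u : K) * z) =
          Algebra.trace F K (((u : K) - 1) * z) + Algebra.trace F K z := by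
        rw [← map_add]; congr 1; ring
      have h4 : normAbs (Algebra.trace F K ((u : K) * z)) ≤ normAbs (ϖ ^ n) ↔
          normAbs (Algebra.trace F K z) ≤ normAbs (ϖ ^ n) := by
        rw [h3]
        exact ⟨fun h => by simpa using normAbs_sub_le_of_le h h2, fun h => normAbs_add_le_of_le h2 h⟩
      simp only [h4]
      ring
    · simp [hz]
  have h2 := integral_eq_mul_integral_comp μK u.ne_zero G
  simp only [h1, hu.1] at h2
  rw [integral_const_mul, Complex.ofReal_one, one_mul] at h2
  have h3 : (1 - (χ⁻¹ u : ℂ)) * ∫ z, G z ∂μK = 0 := by rw [sub_mul, ← h2, one_mul, sub_self]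
  rcases mul_eq_zero.1 h3 with h4 | h4
  · have h5 : χ⁻¹ u = 1 := Circle.ext (by rw [Circle.coe_one]; exact (sub_eq_zero.1 h4).symm)
    exact absurd (inv_eq_one.1 (show (χ u)⁻¹ = 1 from h5)) hu1
  · exact h4

/-- Write `z = a + b δ`. The trace `2a` is divisible by `ϖ^f`, so `b` is a unit and `z = b δ (1 +
a/(b δ))`. Here `χ` is trivial on `b` because `κ` is unramified, and on the last factor by
definition of the conductor. -/
lemma charExt_eq_of_trace_le {ϖ : F} (h : IsUniformizer ϖ) (hf : 1 ≤ conductorExponent χ) {z : K}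
    (hz : normAbs z = 1)
    (htr : normAbs (Algebra.trace F K z) ≤ normAbs (ϖ ^ conductorExponent χ)) :
    charExt χ z = charExt χ δ := by
  obtain ⟨a, b, rfl⟩ := H.exists_eq z
  rw [H.trace_eq, normAbs_mul, H.normAbs_two, one_mul] at htr
  have ha := normAbs_algebraMap_le_iff (K := K).2 htr
  have hK := H.isUnramified ϖ h
  have ha1 : normAbs (algebraMap F K a) < 1 := by
    refine ha.trans_lt ?_
    rw [map_pow, normAbs_pow]
    exact pow_lt_one₀ hK.normAbs_pos.le hK.normAbs_lt_one (by omega)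
  have hb1 : normAbs (algebraMap F K b) = 1 := by
    rw [H.normAbs_add_mul] at hz
    rcases max_choice (normAbs (algebraMap F K a)) (normAbs (algebraMap F K b)) with h' | h'
    · rw [h'] at hz; exact absurd hz ha1.ne
    · rwa [h'] at hz
  have hb : algebraMap F K b * δ ≠ 0 := by
    refine mul_ne_zero ?_ H.gen_ne_zero
    intro h0
    simp [h0] at hb1
  have hne : 1 + algebraMap F K a / (algebraMap F K b * δ) ≠ 0 := by
    intro h0
    have h1 : algebraMap F K a + algebraMap F K b * δ =
        algebraMap F K b * δ * (1 + algebraMap F K a / (algebraMap F K b * δ)) := by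
      rw [mul_add, mul_one, mul_div_cancel₀ _ hb, add_comm]
    rw [h1, h0] at hz
    simp at hz
  have h1 : algebraMap F K a + algebraMap F K b * δ =
      algebraMap F K b * δ * ((Units.mk0 _ hne : Kˣ) : K) := by
    rw [Units.val_mk0, mul_add, mul_one, mul_div_cancel₀ _ hb, add_comm]
  have hmem : Units.mk0 _ hne ∈ higherUnits K (conductorExponent χ) := by
    rw [mem_higherUnits_iff hK]
    have hq : normAbs (algebraMap F K a / (algebraMap F K b * δ)) = normAbs (algebraMap F K a) := by
      rw [normAbs_div, normAbs_mul, hb1, H.normAbs_eq, one_mul, div_one]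
    constructor
    · rw [Units.val_mk0, normAbs_add_eq_of_lt (by rwa [hq, normAbs_one]), normAbs_one]
    · rw [Units.val_mk0, add_sub_cancel_left, hq, ← normAbs_pow, ← map_pow]
      exact ha
  rw [h1, charExt_mul, charExt_units, eq_one_of_mem_higherUnits_conductorExponent χ hmem,
    Circle.coe_one, mul_one, charExt_mul,
    H.charExt_algebraMap_eq_one hκ hχκ (normAbs_algebraMap_eq_one_iff.1 hb1), one_mul]

lemma integral_trace_le {ϖ : F} (h : IsUniformizer ϖ) (hf : 1 ≤ conductorExponent χ) :
    ∃ R : ℝ, 0 < R ∧ ∫ z, {z : K | normAbs z = 1}.indicator 1 z * charExt χ⁻¹ z *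
      {z : K | normAbs (Algebra.trace F K z) ≤ normAbs (ϖ ^ conductorExponent χ)}.indicator 1 z ∂μK =
        R * charExt χ⁻¹ δ := by
  set f := conductorExponent χ with hfdef
  set S : Set K := {z : K | normAbs z = 1} ∩ {z : K | normAbs (Algebra.trace F K z) ≤ normAbs (ϖ ^ f)}
    with hS
  have hK := H.isUnramified ϖ h
  -- The integrand is constant on `S`, so `R` is its volume; it is positive because `S` contains the
  -- ball of radius `|ϖ^f|` about `δ`, an element of trace zero.
  refine ⟨μK.real S, ?_, ?_⟩
  · have hfin : μK S ≠ ⊤ := ((measure_mono fun z hz => le_of_eq hz.1).trans_lt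
      (measure_normAbs_le_lt_top μK 1)).ne
    refine ENNReal.toReal_pos (ne_of_gt ?_) hfin
    have hc : algebraMap F K (ϖ ^ f) ≠ 0 := by simp [h.ne_zero]
    refine lt_of_lt_of_le ((isClopen_normAbs_sub_le δ (normAbs_pos hc)).isOpen.measure_pos μK
      ⟨δ, by rw [Set.mem_ofPred_eq, sub_self, normAbs_zero]; exact normAbs_nonneg _⟩) (measure_mono fun z hz => ?_)
    have hz' : normAbs (z - δ) ≤ normAbs (algebraMap F K (ϖ ^ f)) := hz
    constructor
    · have hlt : normAbs (z - δ) < normAbs δ := by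
        refine hz'.trans_lt ?_
        rw [map_pow, normAbs_pow, H.normAbs_eq]
        exact pow_lt_one₀ hK.normAbs_pos.le hK.normAbs_lt_one (by omega)
      have := normAbs_add_eq_of_lt hlt
      rw [add_sub_cancel, H.normAbs_eq] at this
      exact this
    · have := H.normAbs_trace_le _ hz'
      rwa [map_sub, H.trace_gen, sub_zero] at this
  · have hSm : MeasurableSet S := (measurableSet_normAbs_eq 1).inter (measurableSet_trace_le H _)
    rw [← integral_indicator_one_complex hSm, ← integral_mul_const]
    congr 1; ext z
    by_cases hz1 : normAbs z = 1
    · by_cases hz2 : normAbs (Algebra.trace F K z) ≤ normAbs (ϖ ^ f)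
      · rw [Set.indicator_of_mem (by exact hz1), Set.indicator_of_mem (by exact hz2),
          Set.indicator_of_mem (by exact ⟨hz1, hz2⟩), charExt_inv, charExt_inv,
          H.charExt_eq_of_trace_le hκ hχκ h hf hz1 hz2]
        simp
      · rw [Set.indicator_of_notMem (s := {z : K | normAbs (Algebra.trace F K z) ≤ normAbs (ϖ ^ f)})
          (by exact hz2), Set.indicator_of_notMem (s := S) (fun h' => hz2 h'.2)]
        simp
    · rw [Set.indicator_of_notMem (s := {z : K | normAbs z = 1}) (by exact hz1),
          Set.indicator_of_notMem (s := S) (fun h' => hz1 h'.1)]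
      simp

/-- The Gauss integral of `χ` is a positive multiple of `χ⁻¹(δ)`. -/
lemma gaussIntegral_eq {ϖ : F} (h : IsUniformizer ϖ) (hχ : ¬ IsUnramifiedChar χ)
    {ψ : AddChar F Circle} (hψ : Continuous ψ) {a : F} (ha : IsConductorGenerator ψ a) :
    ∃ R : ℝ, 0 < R ∧ ∫ z, {z : K | normAbs z = 1}.indicator 1 z * charExt χ⁻¹ z *
      (traceChar K ψ (algebraMap F K (a / ϖ ^ conductorExponent χ) * z) : ℂ) ∂μK = R * charExt χ⁻¹ δ := by
  set f := conductorExponent χ with hfdef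
  have hf1 : 1 ≤ f := conductorExponent_pos hχ
  set b := a / ϖ ^ f with hb
  have hϖf : ϖ ^ f ≠ 0 := pow_ne_zero _ h.ne_zero
  have hb0 : b ≠ 0 := div_ne_zero ha.1 hϖf
  borelize F
  let μF : Measure F := Measure.addHaar
  set g : K → ℂ := fun z => {z : K | normAbs z = 1}.indicator 1 z * charExt χ⁻¹ z with hg
  have hgt : IsTame g := (isTame_indicator_eq 1).mul_charExt χ⁻¹
  set I := ∫ z, g z * (traceChar K ψ (algebraMap F K b * z) : ℂ) ∂μK with hI
  -- The substitution `z ↦ xz` with `x` in `U_F` changes neither the measure nor `χ⁻¹(z)`, only the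
  -- argument of `ψ`.
  have hx : ∀ x : F, normAbs x = 1 →
      ∫ z, g z * (ψ (x * (b * Algebra.trace F K z)) : ℂ) ∂μK = I := by
    intro x hx
    have hx' := normAbs_algebraMap_eq_one_iff (K := K).2 hx
    have hx0 : algebraMap F K x ≠ 0 := by
      intro h0; simp [h0] at hx'
    symm
    rw [hI, integral_eq_mul_integral_comp μK hx0, hx', Complex.ofReal_one, one_mul]
    congr 1; ext z
    have h1 : g (algebraMap F K x * z) = g z := by
      simp only [hg, charExt_mul, Set.indicator_apply, Set.mem_ofPred_eq, normAbs_mul, hx', one_mul,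
        Pi.one_apply]
      rw [charExt_inv, H.charExt_algebraMap_eq_one hκ hχκ hx, inv_one, one_mul]
    rw [h1]
    congr 2
    change ψ (Algebra.trace F K _) = _
    rw [H.trace_algebraMap_mul, H.trace_algebraMap_mul, mul_left_comm]
  have hU : IsTame ({x : F | normAbs x = 1}.indicator (1 : F → ℂ)) := isTame_indicator_eq 1
  have hint : Integrable (Function.uncurry fun (x : F) (z : K) =>
      {x : F | normAbs x = 1}.indicator (1 : F → ℂ) x * (g z * (ψ (x * (b * Algebra.trace F K z)) : ℂ)))
      (μF.prod μK) := by
    have h1 := (hU.integrable μF).mul_prod (hgt.integrable μK)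
    have hc : Continuous fun p : F × K => (ψ (p.1 * (b * Algebra.trace F K p.2)) : ℂ) := by
      have := H.continuous_trace
      exact continuous_circle_coe.comp (hψ.comp (continuous_fst.mul
        (continuous_const.mul (this.comp continuous_snd))))
    refine (h1.mul_bdd (c := 1) hc.aestronglyMeasurable
      (Eventually.of_forall fun p => (Circle.norm_coe _).le)).congr (Eventually.of_forall fun p => ?_)
    simp [Function.uncurry, mul_assoc]
  -- Integrating the preceding identity over `U_F` and exchanging the integrals replaces `ψ` by the
  -- Fourier transform of the indicator of `U_F`.
  have havg : (μF.real {x : F | normAbs x = 1} : ℂ) * I =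
      ∫ z, g z * fourier ψ μF ({x : F | normAbs x = 1}.indicator 1) (b * Algebra.trace F K z) ∂μK := by
    rw [← integral_indicator_one_complex (measurableSet_normAbs_eq 1), ← integral_mul_const]
    have h1 : ∀ x : F, {x : F | normAbs x = 1}.indicator (1 : F → ℂ) x * I =
        ∫ z, {x : F | normAbs x = 1}.indicator (1 : F → ℂ) x *
          (g z * (ψ (x * (b * Algebra.trace F K z)) : ℂ)) ∂μK := by
      intro x
      rw [integral_const_mul]
      by_cases hx1 : normAbs x = 1
      · rw [hx x hx1]
      · rw [Set.indicator_of_notMem (by exact hx1), zero_mul, zero_mul]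
    simp only [h1]
    rw [integral_integral_swap hint]
    congr 1; ext z
    rw [fourier, ← integral_const_mul]
    congr 1; ext x
    ring
  have hcond : ∀ (z : K) (n : ℕ), normAbs (b * Algebra.trace F K z) ≤ normAbs (b * ϖ ^ n) ↔
      normAbs (Algebra.trace F K z) ≤ normAbs (ϖ ^ n) := by
    intro z n
    rw [normAbs_mul, normAbs_mul, mul_le_mul_iff_right₀ (normAbs_pos hb0)]
  have hbf : b * ϖ ^ f = a := div_mul_cancel₀ _ hϖf
  have hbf1 : b * ϖ ^ (f - 1) = a / ϖ := by
    rw [eq_div_iff h.ne_zero, mul_assoc, pow_sub_one_mul (by omega), hbf]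
  set m := μF.real {x : F | normAbs x ≤ 1} with hm
  have hm0 : 0 < m := measureReal_normAbs_le_pos one_pos
  have hTint : ∀ n, Integrable (fun z => g z *
      {z : K | normAbs (Algebra.trace F K z) ≤ normAbs (ϖ ^ n)}.indicator 1 z) μK := by
    intro n
    refine (hgt.integrable μK).mul_bdd (c := 1)
      (measurable_one.indicator (measurableSet_trace_le H _)).aestronglyMeasurable
      (Eventually.of_forall fun z => ?_)
    rw [Set.indicator_apply]
    split_ifs <;> simp
  -- As `b ϖ^f = a` and `b ϖ^(f-1) = a/ϖ`, the two balls in the transform become the trace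
  -- conditions of levels `f` and `f - 1`. The second integrates to zero.
  have hsplit : ∀ z, g z * fourier ψ μF ({x : F | normAbs x = 1}.indicator 1) (b * Algebra.trace F K z) =
      m * (g z * {z : K | normAbs (Algebra.trace F K z) ≤ normAbs (ϖ ^ f)}.indicator 1 z) -
        m * normAbs ϖ *
          (g z * {z : K | normAbs (Algebra.trace F K z) ≤ normAbs (ϖ ^ (f - 1))}.indicator 1 z) := by
    intro z
    rw [fourier_indicator_sphere hψ ha h]
    simp only [Set.indicator_apply, Set.mem_ofPred_eq, ← hcond, hbf, hbf1, Pi.one_apply]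
    ring
  obtain ⟨R, hR0, hR⟩ := H.integral_trace_le hκ hχκ (μK := μK) h hf1
  have hzero := H.integral_trace_lt (χ := χ) (μK := μK) h (n := f - 1) (by omega)
  have hU0 : 0 < μF.real {x : F | normAbs x = 1} := measureReal_sphere_pos
  refine ⟨m * R / μF.real {x : F | normAbs x = 1}, by positivity, ?_⟩
  simp only [hsplit] at havg
  rw [integral_sub ((hTint f).const_mul _) ((hTint (f - 1)).const_mul _), integral_const_mul,
    integral_const_mul, hR, hzero, mul_zero, sub_zero] at havg
  have hUC : (μF.real {x : F | normAbs x = 1} : ℂ) ≠ 0 := by exact_mod_cast hU0.ne'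
  push_cast
  field_simp
  linear_combination havg

/-- Normalization removes the positive factors `|b|` and `R` from the epsilon factor. The remaining
value `χ⁻¹(b)` is a value of `κ⁻¹`, because `b` lies in `F`. -/
theorem rootNumber_traceChar {ϖ : F} (h : IsUniformizer ϖ) (hχ : ¬ IsUnramifiedChar χ)
    {ψ : AddChar F Circle} (hψ : Continuous ψ) (hψ1 : ψ ≠ 1) {a : F} (ha : IsConductorGenerator ψ a) :
    rootNumber χ (traceChar K ψ) μK =
      charExt κ⁻¹ (a / ϖ ^ conductorExponent χ) * charExt χ⁻¹ δ := by
  obtain ⟨R, hR0, hR⟩ := H.gaussIntegral_eq hκ hχκ (μK := μK) h hχ hψ ha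
  have hb0 : a / ϖ ^ conductorExponent χ ≠ 0 := div_ne_zero ha.1 (pow_ne_zero _ h.ne_zero)
  have hbK : algebraMap F K (a / ϖ ^ conductorExponent χ) ≠ 0 := by simpa using hb0
  rw [rootNumber, epsilonFactor_of_not_isUnramifiedChar hχ (H.continuous_traceChar hψ)
    (H.traceChar_ne_one hψ1) (H.isConductorGenerator_traceChar ha) (H.isUnramified ϖ h)
    (b := algebraMap F K (a / ϖ ^ conductorExponent χ)) (by rw [map_div₀, map_pow]), hR]
  rw [norm_mul, norm_mul, norm_mul, norm_charExt_of_ne_zero _ hbK, norm_charExt_of_ne_zero _ H.gen_ne_zero,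
    Complex.norm_real, Complex.norm_real, Real.norm_of_nonneg (normAbs_nonneg _),
    Real.norm_of_nonneg hR0.le, charExt_inv, charExt_algebraMap hχκ, ← charExt_inv]
  have h1 : (normAbs (algebraMap F K (a / ϖ ^ conductorExponent χ)) : ℂ) ≠ 0 := by
    exact_mod_cast normAbs_ne_zero hbK
  have h2 : (R : ℂ) ≠ 0 := by exact_mod_cast hR0.ne'
  simp only [mul_one, Complex.ofReal_mul]
  generalize (normAbs (algebraMap F K (a / ϖ ^ conductorExponent χ)) : ℂ) = x at h1
  field_simp

end IsUnramifiedQuadratic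

end QuadraticRootNumber

end LocalRoot

namespace LocalRoot

/-! ### Measures on unit groups and the value of the explicit constant. -/

section UnitsMeasure

variable {K : Type*} [Field K] [ValuativeRel K] [TopologicalSpace K] [IsNonarchimedeanLocalField K]
  [MeasurableSpace K] [BorelSpace K]

lemma range_unitGroup_coe : Set.range (fun u : unitGroup K => ((u : Kˣ) : K)) = {x | normAbs x = 1} := by
  ext x
  constructor
  · rintro ⟨u, rfl⟩
    exact mem_unitGroup_iff.1 u.2
  · intro hx
    have hx0 : x ≠ 0 := by
      rintro rfl
      simp at hx
    exact ⟨⟨Units.mk0 x hx0, mem_unitGroup_iff.2 hx⟩, rfl⟩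

/-- This identifies the comapped measure in `quotientMeasure` with the restriction of `μK` to the
unit sphere. -/
lemma measurableEmbedding_unitGroup_coe :
    MeasurableEmbedding (fun u : unitGroup K => ((u : Kˣ) : K)) where
  injective u v h := Subtype.ext (Units.ext h)
  measurable := (comap_measurable _).comp measurable_subtype_coe
  measurableSet_image' := by
    rintro s ⟨t, ⟨t', ht', rfl⟩, rfl⟩
    have : (fun u : unitGroup K => ((u : Kˣ) : K)) '' (Subtype.val ⁻¹' (Units.val ⁻¹' t')) =
        t' ∩ Set.range (fun u : unitGroup K => ((u : Kˣ) : K)) :=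
      Set.image_preimage_eq_inter_range
    rw [this, range_unitGroup_coe]
    exact ht'.inter (measurableSet_normAbs_eq 1)

end UnitsMeasure

namespace IsUnramifiedQuadratic

variable {F K : Type*} [Field F] [ValuativeRel F] [TopologicalSpace F] [IsNonarchimedeanLocalField F]
    [Field K] [ValuativeRel K] [TopologicalSpace K] [IsNonarchimedeanLocalField K] [Algebra F K]
    [ValuativeExtension F K]
    [MeasurableSpace F] [BorelSpace F] [MeasurableSpace K] [BorelSpace K]
    {D : F} {δ : K} (H : IsUnramifiedQuadratic F D δ)
    (μF : Measure F) [μF.IsAddHaarMeasure] (μK : Measure K) [μK.IsAddHaarMeasure]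
include H

/-- The integral over `V` counts the units whose trace has a given absolute value. -/
lemma lamIntegral_eq {ϖ : F} (h : IsUniformizer ϖ) (f : ℕ) :
    lamIntegral F K μF μK ϖ f = (μF.real {x : F | normAbs x = 1})⁻¹ *
      μK.real {z : K | normAbs z = 1 ∧ normAbs (Algebra.trace F K z) = normAbs (ϖ ^ f)} := by
  have hϖ : ϖ ^ f ≠ 0 := pow_ne_zero _ h.ne_zero
  have hlam : ∀ z : K, lam F K (z / algebraMap F K ϖ ^ f) =
      {z : K | normAbs (Algebra.trace F K z) = normAbs (ϖ ^ f)}.indicator 1 z := by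
    intro z
    have h1 : Algebra.trace F K (z / algebraMap F K ϖ ^ f) = (ϖ ^ f)⁻¹ * Algebra.trace F K z := by
      rw [← H.trace_algebraMap_mul, map_inv₀, map_pow, div_eq_inv_mul]
    rw [lam, Set.indicator_apply]
    refine if_congr ?_ rfl rfl
    rw [h1, ← normAbs_eq_one, normAbs_mul, normAbs_inv, inv_mul_eq_one₀ (normAbs_ne_zero hϖ),
      Set.mem_ofPred_eq, eq_comm]
  set S : Set K := {z : K | normAbs (Algebra.trace F K z) = normAbs (ϖ ^ f)} with hS
  have hSm : MeasurableSet S := H.continuous_trace.measurable (measurableSet_normAbs_eq _)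
  -- The chosen representative differs from `u` by a unit of `F`, which multiplies the trace by a
  -- unit. The integrand therefore descends to `V`, although `Quotient.out` is an arbitrary choice.
  have hout : ∀ u : unitGroup K, S.indicator (1 : K → ℝ)
      ((Quotient.out (u : UnitQuotient F K) : unitGroup K) : Kˣ) =
      S.indicator 1 ((u : Kˣ) : K) := by
    intro u
    obtain ⟨v, hv⟩ := QuotientGroup.mk_out_eq_mul
      (((unitGroup F).map (Units.map (algebraMap F K : F →* K))).subgroupOf (unitGroup K)) u
    obtain ⟨x, hx, hxv⟩ := v.2
    have h2 : ((Quotient.out (u : UnitQuotient F K) : unitGroup K) : Kˣ) =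
        algebraMap F K (x : F) * ((u : Kˣ) : K) := by
      have h3 := congrArg (fun w : unitGroup K => ((w : Kˣ) : K)) hv
      have h4 := congrArg (fun w : Kˣ => (w : K)) hxv
      simp only [Subgroup.coe_mul, Units.val_mul] at h3
      refine h3.trans ?_
      rw [mul_comm]
      congr 1
      exact h4.symm
    rw [h2]
    simp only [hS, Set.indicator_apply, Set.mem_ofPred_eq, H.trace_algebraMap_mul, normAbs_mul,
      mem_unitGroup_iff.1 hx, one_mul, Pi.one_apply]
  have hU : {x : F | valuation F x = 1} = {x : F | normAbs x = 1} := by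
    ext x; exact normAbs_eq_one.symm
  have hmk : Measurable fun u : unitGroup K => (u : UnitQuotient F K) := measurable_quotient_mk''
  have hmeas : Measurable fun z : UnitQuotient F K =>
      S.indicator (1 : K → ℝ) ((Quotient.out z : unitGroup K) : Kˣ) := by
    refine measurable_from_quotient.2 ?_
    have h1 : Measurable fun u : unitGroup K => S.indicator (1 : K → ℝ) ((u : Kˣ) : K) :=
      (measurable_one.indicator hSm).comp measurableEmbedding_unitGroup_coe.measurable
    exact (congrArg Measurable (funext hout)).mpr h1
  simp only [lamIntegral, hlam]
  rw [quotientMeasure, integral_smul_measure, hU, integral_map hmk.aemeasurable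
    hmeas.aestronglyMeasurable]
  simp only [hout]
  have h5 := measurableEmbedding_unitGroup_coe.integral_map (μ := μK.comap
    (fun u : unitGroup K => ((u : Kˣ) : K))) (S.indicator (1 : K → ℝ))
  rw [← h5, measurableEmbedding_unitGroup_coe.map_comap, range_unitGroup_coe, integral_indicator_one hSm,
    measureReal_restrict_apply hSm, ENNReal.toReal_inv, smul_eq_mul]
  congr 2
  ext z
  simp [hS, and_comm]

/-- Both sets are products in the coordinates `a + b δ`. The ball is a product of two balls. In the
second set the trace condition reads `|a| = |c| < 1`, and being a unit then means `|b| = 1`. The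
common constant `C` later cancels. -/
lemma measureReal_ball_eq : ∃ C : ℝ, (∀ c : F, μK.real {z : K | normAbs z ≤ normAbs (algebraMap F K c)} =
      C * (μF.real {x : F | normAbs x ≤ normAbs c}) ^ 2) ∧
    ∀ c : F, normAbs c < 1 →
      μK.real {z : K | normAbs z = 1 ∧ normAbs (Algebra.trace F K z) = normAbs c} =
        C * (μF.real {x : F | normAbs x = normAbs c} * μF.real {x : F | normAbs x = 1}) := by
  obtain ⟨C, hC⟩ := H.exists_measureReal_eq μF μK
  refine ⟨C, fun c => ?_, fun c hc => ?_⟩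
  · rw [sq, ← hC _ _ (measurableSet_normAbs_le _) (measurableSet_normAbs_le _)]
    congr 1; ext z
    constructor
    · intro hz
      obtain ⟨a, b, rfl⟩ := H.exists_eq z
      rw [Set.mem_ofPred_eq, H.normAbs_add_mul, max_le_iff, normAbs_algebraMap_le_iff,
        normAbs_algebraMap_le_iff] at hz
      exact ⟨a, hz.1, b, hz.2, rfl⟩
    · rintro ⟨a, ha, b, hb, rfl⟩
      rw [Set.mem_ofPred_eq, H.normAbs_add_mul, max_le_iff, normAbs_algebraMap_le_iff,
        normAbs_algebraMap_le_iff]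
      exact ⟨ha, hb⟩
  · rw [← hC _ _ (measurableSet_normAbs_eq _) (measurableSet_normAbs_eq _)]
    have key : ∀ a b : F, normAbs a = normAbs c →
        (normAbs (algebraMap F K a + algebraMap F K b * δ) = 1 ↔ normAbs b = 1) := by
      intro a b ha
      have ha1 : normAbs (algebraMap F K a) < 1 := by
        rw [← normAbs_one (K := K), ← map_one (algebraMap F K), normAbs_algebraMap_lt_iff, normAbs_one, ha]
        exact hc
      rw [H.normAbs_add_mul, ← normAbs_algebraMap_eq_one_iff (K := K) (x := b)]
      constructor
      · intro h1
        rcases max_choice (normAbs (algebraMap F K a)) (normAbs (algebraMap F K b)) with h' | h'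
        · rw [h'] at h1; exact absurd h1 ha1.ne
        · rwa [h'] at h1
      · intro h1
        rw [h1, max_eq_right ha1.le]
    congr 1; ext z
    constructor
    · rintro ⟨hz1, hz2⟩
      obtain ⟨a, b, rfl⟩ := H.exists_eq z
      rw [H.trace_eq, normAbs_mul, H.normAbs_two, one_mul] at hz2
      exact ⟨a, hz2, b, (key a b hz2).1 hz1, rfl⟩
    · rintro ⟨a, ha, b, hb, rfl⟩
      refine ⟨(key a b ha).2 hb, ?_⟩
      rw [H.trace_eq, normAbs_mul, H.normAbs_two, one_mul]
      exact ha

omit [MeasurableSpace F] [BorelSpace F] [MeasurableSpace K] [BorelSpace K] in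
-- Compare how multiplication by `ϖ` scales the unit ball of `K`, by `q_K⁻¹`, with how it scales a
-- product of two unit balls of `F`, by `q_F⁻²`.
lemma residueCard_eq : residueCard K = residueCard F ^ 2 := by
  borelize F
  borelize K
  obtain ⟨ϖ, h⟩ := exists_isUniformizer F
  have hK := H.isUnramified ϖ h
  obtain ⟨C, hC, -⟩ := H.measureReal_ball_eq (Measure.addHaar : Measure F) (Measure.addHaar : Measure K)
  have h1 := hC 1
  have h2 := hC ϖ
  rw [measureReal_ball_uniformizer h, measureReal_ball_uniformizer hK] at h2
  rw [map_one, normAbs_one, normAbs_one] at h1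
  have h3 : 0 < (Measure.addHaar : Measure K).real {z : K | normAbs z ≤ 1} :=
    measureReal_normAbs_le_pos one_pos
  have h4 : normAbs (algebraMap F K ϖ) = normAbs ϖ ^ 2 := by
    refine mul_right_cancel₀ h3.ne' ?_
    rw [h2, h1]; ring
  rw [h.normAbs_eq, hK.normAbs_eq, inv_pow, inv_inj] at h4
  exact_mod_cast h4

/-- The volumes are `vol(𝒪_K) = C vol(𝒪_F)²` and, for units with `|tr z| = |ϖ^f|`, `C q_F^(-f)
vol(U_F)²`. With `vol(U_F) = (1 - q_F⁻¹) vol(𝒪_F)` and `q_K^(f/2) = q_F^f` everything cancels. The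
condition `f ≥ 1` puts the trace in the maximal ideal. -/
lemma constant_eq_one {ϖ : F} (h : IsUniformizer ϖ) {f : ℕ} (hf : 1 ≤ f) :
    (1 - (residueCard F : ℝ)⁻¹)⁻¹ * (residueCard K : ℝ) ^ ((f : ℝ) / 2)
      * (μF.real {x : F | valuation F x ≤ 1} / μK.real {x : K | valuation K x ≤ 1})
      * lamIntegral F K μF μK ϖ f = 1 := by
  have hF : {x : F | valuation F x ≤ 1} = {x : F | normAbs x ≤ 1} := by
    ext x; exact normAbs_le_one.symm
  have hK : {x : K | valuation K x ≤ 1} = {x : K | normAbs x ≤ 1} := by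
    ext x; exact normAbs_le_one.symm
  obtain ⟨C, hC1, hC2⟩ := H.measureReal_ball_eq μF μK
  have hO := hC1 1
  rw [map_one, normAbs_one, normAbs_one] at hO
  have hlt : normAbs (ϖ ^ f) < 1 := by
    rw [normAbs_pow]
    exact pow_lt_one₀ h.normAbs_pos.le h.normAbs_lt_one (by omega)
  have hsph : μF.real {x : F | normAbs x = normAbs (ϖ ^ f)} =
      normAbs ϖ ^ f * μF.real {x : F | normAbs x = 1} := by
    have hc := pow_ne_zero f h.ne_zero
    have h1 := measure_mul_preimage μF (inv_ne_zero hc) {x : F | normAbs x = 1}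
    have h2 : (fun x => (ϖ ^ f)⁻¹ * x) ⁻¹' {x : F | normAbs x = 1} =
        {x : F | normAbs x = normAbs (ϖ ^ f)} := by
      ext x
      rw [Set.mem_preimage, Set.mem_ofPred_eq, normAbs_mul, normAbs_inv,
        inv_mul_eq_one₀ (normAbs_ne_zero hc), Set.mem_ofPred_eq, eq_comm]
    rw [h2, normAbs_inv, inv_inv] at h1
    rw [Measure.real, h1, ENNReal.toReal_mul, ENNReal.toReal_ofReal (normAbs_nonneg _), normAbs_pow]
    rfl
  have hq : (residueCard K : ℝ) ^ ((f : ℝ) / 2) = (residueCard F : ℝ) ^ f := by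
    rw [H.residueCard_eq, Nat.cast_pow, ← Real.rpow_natCast, ← Real.rpow_mul (residueCard_pos F).le,
      ← Real.rpow_natCast]
    congr 1
    push_cast
    ring
  have hm : 0 < μF.real {x : F | normAbs x ≤ 1} := measureReal_normAbs_le_pos one_pos
  have hmK : 0 < μK.real {x : K | normAbs x ≤ 1} := measureReal_normAbs_le_pos one_pos
  have hC0 : C ≠ 0 := by
    rintro rfl
    rw [zero_mul] at hO
    exact hmK.ne' hO
  have hqpos := residueCard_pos F
  rw [H.lamIntegral_eq μF μK h, hC2 _ hlt, hsph, hF, hK, hO, hq, measureReal_sphere h, h.normAbs_eq]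
  have h1q : (1 - (residueCard F : ℝ)⁻¹) ≠ 0 := by
    have := inv_lt_one_of_one_lt₀ (one_lt_residueCard_real F)
    linarith
  generalize (1 - (residueCard F : ℝ)⁻¹) = t at h1q ⊢
  field_simp
  rw [← mul_pow, mul_one_div_cancel hqpos.ne', one_pow]

end IsUnramifiedQuadratic

end LocalRoot

theorem mainTheorem8
    {F K : Type*}
    [Field F] [ValuativeRel F] [TopologicalSpace F] [IsNonarchimedeanLocalField F] [CharZero F]
    [Field K] [ValuativeRel K] [TopologicalSpace K] [IsNonarchimedeanLocalField K]
    [Algebra F K] [ValuativeExtension F K]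
    [MeasurableSpace F] [BorelSpace F] [MeasurableSpace K] [BorelSpace K]
    -- odd residue characteristic; `K/F` is quadratic and unramified
    (hp : ringChar 𝓀[F] ≠ 2)
    (hdeg : Module.finrank F K = 2)
    (hunr : LocalRoot.IsUnramifiedExtension F K)
    -- `K = F(√-D)` with `√-D` a unit of `K`
    (D : F) (sqrtNegD : Kˣ)
    (hD : (sqrtNegD : K) ^ 2 = algebraMap F K (-D))
    (hgen : IntermediateField.adjoin F {(sqrtNegD : K)} = ⊤)
    (hDunit : sqrtNegD ∈ LocalRoot.unitGroup K)
    -- the quadratic character `κ` and a ramified unitary character `χ` restricting to it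
    (κ : Fˣ →ₜ* Circle) (hκ : LocalRoot.IsQuadraticCharacter F K κ)
    (χ : Kˣ →ₜ* Circle)
    (hχκ : ∀ x : Fˣ, χ (Units.map (algebraMap F K : F →* K) x) = κ x)
    (hχ : ¬ LocalRoot.IsUnramifiedChar χ)
    -- the additive character of `F`, and Haar measures used to define the root numbers
    (ψ : AddChar F Circle) (hψ : Continuous ψ) (hψ1 : ψ ≠ 1)
    (νF : Measure F) [νF.IsAddHaarMeasure] (νK : Measure K) [νK.IsAddHaarMeasure]
    -- the uniformizer and the Haar measures used in the formula
    (ϖ : F) (hϖ : LocalRoot.IsUniformizer ϖ)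
    (μF : Measure F) [μF.IsAddHaarMeasure] (μK : Measure K) [μK.IsAddHaarMeasure]
    (f : ℕ) (hf : f = LocalRoot.conductorExponent χ)
    (c : ℝ)
    (hc : c = (1 - (LocalRoot.residueCard F : ℝ)⁻¹)⁻¹
      * (LocalRoot.residueCard K : ℝ) ^ ((f : ℝ) / 2)
      * (μF.real {x : F | valuation F x ≤ 1} / μK.real {x : K | valuation K x ≤ 1})
      * LocalRoot.lamIntegral F K μF μK ϖ f) :
    1 ≤ f ∧ 0 < c ∧
    LocalRoot.relativeRootNumber κ χ ψ νF νK
      = (c : ℂ) * ((-1) ^ f * ((χ⁻¹ sqrtNegD : Circle) : ℂ)) ∧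
    LocalRoot.relativeRootNumber κ χ ψ νF νK = (-1) ^ f * ((χ⁻¹ sqrtNegD : Circle) : ℂ) ∧
    (((-1) ^ f * ((χ⁻¹ sqrtNegD : Circle) : ℂ) = 1) ∨
      ((-1) ^ f * ((χ⁻¹ sqrtNegD : Circle) : ℂ) = -1)) := by
  open LocalRoot in
  have H : IsUnramifiedQuadratic F D (sqrtNegD : K) :=
    ⟨hp, hdeg, hunr, hD, hgen, mem_unitGroup_iff.1 hDunit⟩
  have hf1 : 1 ≤ f := hf ▸ conductorExponent_pos hχ
  have hc1 : c = 1 := hc.trans (H.constant_eq_one μF μK hϖ hf1)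
  obtain ⟨a, ha⟩ := exists_isConductorGenerator hψ hψ1
  have hW : relativeRootNumber κ χ ψ νF νK = (-1) ^ f * ((χ⁻¹ sqrtNegD : Circle) : ℂ) := by
    -- The only trace of the conductor of `χ` in the quotient: `κ(ϖ) = -1` contributes `(-1)^f`,
    -- while `κ⁻¹(a)` cancels against `W(κ, ψ)`.
    have hκf : charExt κ⁻¹ (a / ϖ ^ f) = charExt κ⁻¹ a * (-1) ^ f := by
      have h1 : charExt κ⁻¹ (a / ϖ ^ f) * charExt κ⁻¹ (ϖ ^ f) = charExt κ⁻¹ a := by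
        rw [← charExt_mul, div_mul_cancel₀ _ (pow_ne_zero _ hϖ.ne_zero)]
      rw [charExt_pow, charExt_inv κ ϖ, H.charExt_uniformizer hκ hϖ, inv_neg, inv_one] at h1
      rw [← h1, mul_assoc, ← mul_pow]
      simp
    have hκa : charExt κ⁻¹ a ≠ 0 := by
      rw [← norm_ne_zero_iff, norm_charExt_of_ne_zero _ ha.1]
      exact one_ne_zero
    rw [relativeRootNumber, H.rootNumber_traceChar hκ hχκ hϖ hχ hψ hψ1 ha, ← hf,
      rootNumber_of_isUnramifiedChar (H.isUnramifiedChar hκ) hψ hψ1 ha, hκf, charExt_units]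
    field_simp
  refine ⟨hf1, by rw [hc1]; exact one_pos, by rw [hc1, Complex.ofReal_one, one_mul]; exact hW, hW, ?_⟩
  -- The square of `√-D` is the unit `-D` of `F`, on which `χ` is trivial; hence the final value is
  -- a sign.
  have hsq : charExt χ (sqrtNegD : K) ^ 2 = 1 := by
    rw [sq, ← charExt_mul, ← sq, hD, H.charExt_algebraMap_eq_one hκ hχκ]
    rw [normAbs_neg, H.normAbs_D]
  have hinv : ((χ⁻¹ sqrtNegD : Circle) : ℂ) = (charExt χ (sqrtNegD : K))⁻¹ := by
    rw [← charExt_inv, charExt_units]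
  refine sq_eq_sq_iff_eq_or_eq_neg.1 (Eq.trans ?_ (one_pow 2).symm)
  rw [mul_pow, hinv, inv_pow, hsq, ← pow_mul, mul_comm f 2, pow_mul]
  simp
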